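/- Let $N\ge 1$ be an integer, let $\omega,\phi\in\mathbb R$ and $k\ge 0$, and take indices $n$ mod $N$. Let $A(\phi)$ be the $N\times N$ matrix with $(A(\phi)c)_n=e^{i\phi}c_{n-1}+e^{-i\phi}c_{n+1}$, and put $A_c(\phi)=\operatorname{Re}A(\phi)$, $A_s(\phi)=\operatorname{Im}A(\phi)$. Let $c=(u_n+iv_n)_n:\mathbb R\to\mathbb C^N$ be a pulse, i.e. a $C^2$ solution of $$\ddot c_n+k\left(e^{i\phi}c_{n-1}+e^{-i\phi}c_{n+1}\right)+|c_n|^2c_n-\omega c_n=0,\qquad c_n(t)\to0\ \text{ as } t\to\pm\infty .$$ Let $\mathcal L(c)$ be the linearization $$\mathcal L(c)=\begin{pmatrix} kA_s+2\,\mathrm{diag}(u_nv_n) & \partial_t^2-\omega+kA_c+\mathrm{diag}(u_n^2)+3\,\mathrm{diag}(v_n^2)\\ -\partial_t^2+\omega-kA_c-3\,\mathrm{diag}(u_n^2)-\mathrm{diag}(v_n^2) & kA_s-2\,\mathrm{diag}(u_nv_n)\end{pmatrix},$$ an unbounded operator on $L^2(\mathbb R,\mathbb R^{2N})$ with domain $H^2(\mathbb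 R,\mathbb R^{2N})$, extended complex-linearly to $L^2(\mathbb R,\mathbb C^{2N})$ with domain $H^2(\mathbb R,\mathbb C^{2N})$. Its essential spectrum $\sigma_{\rm ess}$ is the set of $\lambda\in\mathbb C$ for which $\mathcal L(c)-\lambda\mathcal I$ is not Fredholm, i.e. does not have a finite-dimensional kernel and a closed range of finite codimension. Define $$\alpha(\phi)=\begin{cases}\omega-2k\cos\phi, & 0\le\phi\le\frac{\pi}{N},\\ \omega-2k\cos\left(\frac{2\pi}{N}-\phi\right), & \frac{\pi}{N}\le\phi\le\frac{2\pi}{N},\end{cases}$$ and extend $\alpha$ to all $\phi\in\mathbb R$ with period $2\pi/N$. If $\alpha(\phi)>0$, then the essential spectrum consists of two symmetric, disjoint bands on the imaginary axis: $$\sigma_{\rm ess}=i(-\infty,-\alpha(\phi)]\cup i[\alpha(\phi),\infty).$$ Moreover, as a function of $\phi$, $\alpha$ attains its maximum at $\phi=\pi/N$, where $\alpha(\pi/N)=\omega-2k\cos(\pi/N)$. -/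

import Mathlib

open MeasureTheory Filter Topology
open scoped SchwartzMap LineDeriv ENNReal

noncomputable section

namespace TwistedFiber

/-! ### Unbounded operators, Fredholm property, essential spectrum -/

/-- A linear map `T`, defined on the domain `D` of an (in general unbounded) operator, is Fredholm
if its kernel is finite dimensional and its range is closed and of finite codimension. -/
structure IsFredholm {D E : Type*} [AddCommGroup D] [Module ℂ D] [NormedAddCommGroup E]
    [NormedSpace ℂ E] (T : D →ₗ[ℂ] E) : Prop where
  finite_ker : FiniteDimensional ℂ (LinearMap.ker T)
  isClosed_range : IsClosed (LinearMap.range T : Set E)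
  finite_coker : FiniteDimensional ℂ (E ⧸ LinearMap.range T)

/-- The essential spectrum of an unbounded operator `T` on `E`: all `z : ℂ` for which
`T - z`, with the domain of `T`, is not Fredholm. -/
def essentialSpectrum {E : Type*} [NormedAddCommGroup E] [NormedSpace ℂ E] (T : E →ₗ.[ℂ] E) :
    Set ℂ :=
  {z : ℂ | ¬ IsFredholm (T.toFun - z • T.domain.subtype)}

/-! ### The spaces `L²(ℝ, ℂ^{2N})` and `H²(ℝ, ℂ^{2N})`, and the operator `∂ₜ²` -/

/-- The complexification of `ℝ^{2N}`; the indices `Sum.inl n`, `Sum.inr n` carry the components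
of `u` and `v`, and the sites `n` are taken mod `N`. -/
abbrev Vec (N : ℕ) [NeZero N] : Type := EuclideanSpace ℂ (ZMod N ⊕ ZMod N)

/-- `L²(ℝ, ℂ^{2N})`. -/
abbrev L2 (N : ℕ) [NeZero N] : Type := Lp (Vec N) 2 (volume : Measure ℝ)

/-- The Sobolev space `H²(ℝ, ℂ^{2N})` as a subspace of `L²(ℝ, ℂ^{2N})`. -/
def H2 (N : ℕ) [NeZero N] : Submodule ℂ (L2 N) where
  carrier := {f | TemperedDistribution.MemSobolev 2 2 (f : 𝓢'(ℝ, Vec N))}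
  add_mem' {f g} hf hg := by
    have h := TemperedDistribution.MemSobolev.add hf hg
    rw [Set.mem_ofPred_eq, ← Lp.toTemperedDistributionCLM_apply, map_add]
    exact h
  zero_mem' := by
    rw [Set.mem_ofPred_eq, ← Lp.toTemperedDistributionCLM_apply, map_zero]
    exact TemperedDistribution.memSobolev_fun_zero _ _ _ _
  smul_mem' a f hf := by
    have h := TemperedDistribution.MemSobolev.smul a hf
    rw [Set.mem_ofPred_eq, ← Lp.toTemperedDistributionCLM_apply, map_smul]
    exact h

/-- The second distributional derivative of an `H²` function is (a unique) `L²` function. -/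
theorem exists_secondDeriv {N : ℕ} [NeZero N] (f : H2 N) :
    ∃ g : L2 N, (g : 𝓢'(ℝ, Vec N)) = ∂_{(1 : ℝ)} (∂_{(1 : ℝ)} ((f : L2 N) : 𝓢'(ℝ, Vec N))) := by
  have hf : TemperedDistribution.MemSobolev 2 2 ((f : L2 N) : 𝓢'(ℝ, Vec N)) := f.2
  have h := (hf.lineDerivOp (m := (1 : ℝ))).lineDerivOp (m := (1 : ℝ))
  have h0 : (2 - 1 - 1 : ℝ) = 0 := by norm_num
  rw [h0, TemperedDistribution.memSobolev_zero_iff] at h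
  obtain ⟨g, hg⟩ := h
  exact ⟨g, hg.symm⟩

theorem toTemperedDistribution_inj {N : ℕ} [NeZero N] {f g : L2 N}
    (h : (f : 𝓢'(ℝ, Vec N)) = (g : 𝓢'(ℝ, Vec N))) : f = g :=
  LinearMap.ker_eq_bot.mp
    (Lp.ker_toTemperedDistributionCLM_eq_bot (F := Vec N) (μ := (volume : Measure ℝ)) (p := 2)) h

/-- `∂ₜ² : H²(ℝ, ℂ^{2N}) → L²(ℝ, ℂ^{2N})`, in the sense of distributions. -/
def secondDeriv (N : ℕ) [NeZero N] : H2 N →ₗ[ℂ] L2 N where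
  toFun f := (exists_secondDeriv f).choose
  map_add' f g := by
    apply toTemperedDistribution_inj
    rw [← Lp.toTemperedDistributionCLM_apply (_ + _), map_add]
    simp only [Lp.toTemperedDistributionCLM_apply]
    rw [(exists_secondDeriv (f + g)).choose_spec, (exists_secondDeriv f).choose_spec,
      (exists_secondDeriv g).choose_spec, Submodule.coe_add,
      ← Lp.toTemperedDistributionCLM_apply (_ + _), map_add]
    simp only [Lp.toTemperedDistributionCLM_apply, LineDeriv.lineDerivOp_add]
  map_smul' a f := by
    apply toTemperedDistribution_inj
    rw [← Lp.toTemperedDistributionCLM_apply (_ • _), map_smul]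
    simp only [Lp.toTemperedDistributionCLM_apply, RingHom.id_apply]
    rw [(exists_secondDeriv (a • f)).choose_spec, (exists_secondDeriv f).choose_spec,
      Submodule.coe_smul, ← Lp.toTemperedDistributionCLM_apply (_ • _), map_smul]
    simp only [Lp.toTemperedDistributionCLM_apply, LineDeriv.lineDerivOp_smul]

/-! ### The waveguide system -/

/-- The coupling matrix `A(φ)`: `(A(φ) c)ₙ = e^{iφ} cₙ₋₁ + e^{-iφ} cₙ₊₁`, indices mod `N`. -/
def couplingMatrix (N : ℕ) [NeZero N] (φ : ℝ) : Matrix (ZMod N) (ZMod N) ℂ :=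
  Matrix.of fun n m =>
    (if m = n - 1 then Complex.exp (Complex.I * φ) else 0) +
      (if m = n + 1 then Complex.exp (-(Complex.I * φ)) else 0)

/-- `A_c(φ) = Re A(φ)`. -/
def couplingRe (N : ℕ) [NeZero N] (φ : ℝ) : Matrix (ZMod N) (ZMod N) ℝ :=
  (couplingMatrix N φ).map Complex.re

/-- `A_s(φ) = Im A(φ)`. -/
def couplingIm (N : ℕ) [NeZero N] (φ : ℝ) : Matrix (ZMod N) (ZMod N) ℝ :=
  (couplingMatrix N φ).map Complex.im

/-- A pulse: a (classical) solution `C` of the standing wave system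
`C'' + k A(φ) C + diag(|Cₙ|²) C - ω C = 0` that is localized in `t`. -/
structure Pulse (N : ℕ) [NeZero N] (ω k φ : ℝ) where
  toFun : ℝ → ZMod N → ℂ
  contDiff : ContDiff ℝ 2 toFun
  standing_wave : ∀ t n,
    iteratedDeriv 2 (fun s => toFun s n) t
      + k * ((couplingMatrix N φ).mulVec (toFun t) n)
      + (‖toFun t n‖ : ℂ) ^ 2 * toFun t n - ω * toFun t n = 0
  decay : ∀ n, Tendsto (fun t => toFun t n) (cocompact ℝ) (𝓝 0)

/-- The zero order part of the linearization about the state `c`, `cₙ = uₙ + i vₙ`: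
the real `2N × 2N` matrix
`[[k A_s + 2 diag(uₙvₙ), -ω + k A_c + diag(uₙ²) + 3 diag(vₙ²)],`
` [ω - k A_c - 3 diag(uₙ²) - diag(vₙ²), k A_s - 2 diag(uₙvₙ)]]`. -/
def zeroOrderMatrix (N : ℕ) [NeZero N] (ω k φ : ℝ) (c : ZMod N → ℂ) :
    Matrix (ZMod N ⊕ ZMod N) (ZMod N ⊕ ZMod N) ℝ :=
  Matrix.fromBlocks
    (k • couplingIm N φ + 2 • Matrix.diagonal (fun n => (c n).re * (c n).im))
    (-(ω • (1 : Matrix (ZMod N) (ZMod N) ℝ)) + k • couplingRe N φ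
      + Matrix.diagonal (fun n => (c n).re ^ 2) + 3 • Matrix.diagonal (fun n => (c n).im ^ 2))
    (ω • (1 : Matrix (ZMod N) (ZMod N) ℝ) - k • couplingRe N φ
      - 3 • Matrix.diagonal (fun n => (c n).re ^ 2) - Matrix.diagonal (fun n => (c n).im ^ 2))
    (k • couplingIm N φ - 2 • Matrix.diagonal (fun n => (c n).re * (c n).im))

/-- The matrix `[[0, 1], [-1, 0]]` in front of `∂ₜ²`. -/
def symplecticMatrix (N : ℕ) [NeZero N] : Matrix (ZMod N ⊕ ZMod N) (ZMod N ⊕ ZMod N) ℝ :=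
  Matrix.fromBlocks 0 1 (-1) 0

/-- A real `2N × 2N` matrix acting on `ℂ^{2N}`. -/
def matAct {N : ℕ} [NeZero N] (M : Matrix (ZMod N ⊕ ZMod N) (ZMod N ⊕ ZMod N) ℝ) :
    Vec N →L[ℂ] Vec N :=
  Matrix.toEuclideanCLM (𝕜 := ℂ) (M.map Complex.ofReal)

theorem continuous_zeroOrder (N : ℕ) [NeZero N] (ω k φ : ℝ) :
    Continuous fun c : ZMod N → ℂ => matAct (zeroOrderMatrix N ω k φ c) := by
  have h1 : Continuous fun c : ZMod N → ℂ =>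
      (zeroOrderMatrix N ω k φ c).map Complex.ofReal := by
    refine Continuous.matrix_map ?_ Complex.continuous_ofReal
    unfold zeroOrderMatrix
    fun_prop
  have h2 : Continuous (Matrix.toEuclideanCLM (n := ZMod N ⊕ ZMod N) (𝕜 := ℂ)) :=
    LinearMap.continuous_of_finiteDimensional
      (Matrix.toEuclideanCLM (n := ZMod N ⊕ ZMod N) (𝕜 := ℂ)).toAlgEquiv.toLinearEquiv.toLinearMap
  exact h2.comp h1

namespace Pulse

variable {N : ℕ} [NeZero N] {ω k φ : ℝ}

theorem continuous_potential (P : Pulse N ω k φ) :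
    Continuous fun t => matAct (zeroOrderMatrix N ω k φ (P.toFun t)) :=
  (continuous_zeroOrder N ω k φ).comp P.contDiff.continuous

theorem bounded_potential (P : Pulse N ω k φ) :
    ∃ K : ℝ, ∀ t, ‖matAct (zeroOrderMatrix N ω k φ (P.toFun t))‖ ≤ K := by
  have hd : Tendsto P.toFun (cocompact ℝ) (𝓝 0) := tendsto_pi_nhds.mpr P.decay
  obtain ⟨R, hR⟩ := (Metric.isBounded_iff_subset_closedBall (0 : ZMod N → ℂ)).mp
    (ZeroAtInftyContinuousMap.isBounded_range
      (⟨⟨P.toFun, P.contDiff.continuous⟩, hd⟩ : ZeroAtInftyContinuousMap ℝ (ZMod N → ℂ)))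
  obtain ⟨K, hK⟩ := (isCompact_closedBall (0 : ZMod N → ℂ) R).exists_bound_of_continuousOn
    (continuous_zeroOrder N ω k φ).continuousOn
  exact ⟨K, fun t => hK _ (hR (Set.mem_range_self t))⟩

theorem memLp_potential (P : Pulse N ω k φ) (f : L2 N) :
    MemLp (fun t => matAct (zeroOrderMatrix N ω k φ (P.toFun t)) (f t)) 2
      (volume : Measure ℝ) := by
  obtain ⟨K, hK⟩ := P.bounded_potential
  refine MemLp.of_le_mul (c := K) (Lp.memLp f) ?_ (Eventually.of_forall fun t => ?_)
  · exact (isBoundedBilinearMap_apply (𝕜 := ℂ) (E := Vec N) (F := Vec N)).continuous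
      |>.comp_aestronglyMeasurable
        (P.continuous_potential.aestronglyMeasurable.prodMk (Lp.aestronglyMeasurable f))
  · exact (ContinuousLinearMap.le_opNorm _ _).trans
      (mul_le_mul_of_nonneg_right (hK t) (norm_nonneg _))

/-- Multiplication by the zero order part of the linearization about the pulse,
`(M f)(t) = M(t) f(t)`. -/
def potentialOp (P : Pulse N ω k φ) : L2 N →ₗ[ℂ] L2 N where
  toFun f := (P.memLp_potential f).toLp _
  map_add' f g := by
    rw [← MemLp.toLp_add]
    apply MemLp.toLp_congr
    filter_upwards [Lp.coeFn_add f g] with t ht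
    rw [ht, Pi.add_apply, Pi.add_apply, map_add]
  map_smul' a f := by
    rw [RingHom.id_apply, ← MemLp.toLp_const_smul]
    apply MemLp.toLp_congr
    filter_upwards [Lp.coeFn_smul a f] with t ht
    rw [ht, Pi.smul_apply, Pi.smul_apply, map_smul]

/-- The linearization `𝓛(c)` about the pulse, an unbounded operator on `L²(ℝ, ℂ^{2N})` with domain
`H²(ℝ, ℂ^{2N})`:
`[[k A_s + 2 diag(uₙvₙ), ∂ₜ² - ω + k A_c + diag(uₙ²) + 3 diag(vₙ²)],`
` [-∂ₜ² + ω - k A_c - 3 diag(uₙ²) - diag(vₙ²), k A_s - 2 diag(uₙvₙ)]]`. -/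
def linearization (P : Pulse N ω k φ) : L2 N →ₗ.[ℂ] L2 N where
  domain := H2 N
  toFun :=
    ((matAct (symplecticMatrix N)).compLpL 2 (volume : Measure ℝ)).toLinearMap ∘ₗ secondDeriv N
      + P.potentialOp ∘ₗ (H2 N).subtype

end Pulse

/-! ### The edge of the essential spectrum -/

/-- `α` on the fundamental interval `0 ≤ φ ≤ 2π/N`. -/
def edgeBase (N : ℕ) (ω k φ : ℝ) : ℝ :=
  if φ ≤ Real.pi / N then ω - 2 * k * Real.cos φ
  else ω - 2 * k * Real.cos (2 * Real.pi / N - φ)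

theorem period_pos (N : ℕ) [NeZero N] : 0 < 2 * Real.pi / (N : ℝ) :=
  div_pos Real.two_pi_pos (Nat.cast_pos.mpr (NeZero.pos N))

/-- `α`, extended `2π/N`-periodically to all `φ : ℝ`. -/
def edge (N : ℕ) [NeZero N] (ω k φ : ℝ) : ℝ :=
  edgeBase N ω k (toIcoMod (period_pos N) 0 φ)

/-- The upper band `i [a, ∞)`. -/
def upperBand (a : ℝ) : Set ℂ := (fun s : ℝ => Complex.I * (s : ℂ)) '' Set.Ici a

/-- The lower band `i (-∞, -a]`. -/
def lowerBand (a : ℝ) : Set ℂ := (fun s : ℝ => Complex.I * (s : ℂ)) '' Set.Iic (-a)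

end TwistedFiber

end

/-! This is Weyl's theorem: the essential spectrum only sees the constant coefficient operator that
remains as `t → ±∞`. Composing `𝓛(c) - z` with the Bessel potential `(1 + x²)⁻¹`, a bijection from
`L²` onto `H²`, gives a bounded operator on `L²` without changing Fredholmness
(`linearization_comp_besselEquiv`). It is the sum of two terms. One is a Fourier multiplier with
matrix symbol `(1 + x²)⁻¹ (M₀ - 4π²x² J - z)`, where `M₀` is the zero order matrix at the zero state
and `J` is the symplectic matrix. The other has the form `Φ(t) Ψ(D)` with `Φ` and `Ψ` vanishing at
infinity, hence is a norm limit of finite rank operators (`mulOp_fourierInv_mulOp_mem`).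

The symbol tends to the invertible matrix `-4π² J`. If it is invertible at every `x`, the multiplier
is invertible and the sum is Fredholm (`isFredholm_isUnit_add`). If it is singular at some `x₀`,
normalized indicators of disjoint intervals shrinking to `x₀` give an orthonormal sequence sent to
`0`; the compact term sends it to `0` too, which a Fredholm operator forbids
(`not_tendsto_of_isFredholm`). So `z` is in the essential spectrum iff it is an eigenvalue of `M₀ -
s J` for some `s ≥ 0`.

In the coordinates `u ± iv` the matrix `M₀ - s J` splits into `i(ω + s - k A(φ))` and `-i(ω + s - k
A(-φ))`. The circulant `A(φ)` is diagonalized by the characters of `ℤ/N`, with eigenvalues `2 cos(φ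
+ 2πj/N)`. Hence the eigenvalues are `±i(s + ω - 2k cos(φ + 2πj/N))`; letting `s` run over `[0, ∞)`
fills the half-lines starting at the least value over `j`. As `k ≥ 0`, that value comes from the
point of `φ + (2π/N)ℤ` nearest to `0`, and it is `α(φ)` (`edge_le`, `exists_edge_eq_cos`). The
condition `α > 0` separates the two half-lines. -/

noncomputable section

namespace TwistedFiber

/-! ### Norm limits of finite rank operators and Fredholm operators -/

section Abstract

variable {E F G : Type*} [NormedAddCommGroup E] [NormedSpace ℂ E] [NormedAddCommGroup F]
  [NormedSpace ℂ F] [NormedAddCommGroup G] [NormedSpace ℂ G]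

variable (E F) in
/-- The continuous linear maps of finite rank. -/
def finiteRank : Submodule ℂ (E →L[ℂ] F) :=
  (LinearMap.finiteRange ℂ E F).comap (ContinuousLinearMap.coeLM ℂ)

variable (E F) in
/-- The norm closure of the continuous linear maps of finite rank. -/
def approxFiniteRank : Submodule ℂ (E →L[ℂ] F) :=
  (finiteRank E F).topologicalClosure

theorem mem_finiteRank {T : E →L[ℂ] F} :
    T ∈ finiteRank E F ↔ (T : E →ₗ[ℂ] F).HasFiniteRange := by
  simp [finiteRank, LinearMap.mem_finiteRange_iff_hasFiniteRange]

theorem mem_approxFiniteRank_iff {T : E →L[ℂ] F} :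
    T ∈ approxFiniteRank E F ↔ ∀ ε > 0, ∃ S ∈ finiteRank E F, ‖T - S‖ < ε := by
  rw [approxFiniteRank, ← SetLike.mem_coe, Submodule.topologicalClosure_coe,
    Metric.mem_closure_iff]
  simp [dist_eq_norm]

theorem mem_approxFiniteRank_of_forall_norm_sub_le {T : E →L[ℂ] F}
    (h : ∀ ε > 0, ∃ S ∈ approxFiniteRank E F, ‖T - S‖ ≤ ε) : T ∈ approxFiniteRank E F := by
  have hc : IsClosed (approxFiniteRank E F : Set (E →L[ℂ] F)) :=
    Submodule.isClosed_topologicalClosure _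
  rw [← SetLike.mem_coe, ← hc.closure_eq, Metric.mem_closure_iff]
  intro ε hε
  obtain ⟨S, hS, hTS⟩ := h (ε / 2) (half_pos hε)
  exact ⟨S, hS, by rw [dist_eq_norm]; linarith⟩

theorem comp_mem_approxFiniteRank {T : E →L[ℂ] F} (hT : T ∈ approxFiniteRank E F) (L : F →L[ℂ] G) :
    L ∘L T ∈ approxFiniteRank E G := by
  rw [approxFiniteRank, ← SetLike.mem_coe, Submodule.topologicalClosure_coe] at *
  refine map_mem_closure (f := fun T : E →L[ℂ] F => L ∘L T) (by fun_prop) hT fun S hS => ?_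
  exact mem_finiteRank.2 ((mem_finiteRank.1 hS).comp_left (L : F →ₗ[ℂ] G))

theorem mem_approxFiniteRank_comp {T : F →L[ℂ] G} (hT : T ∈ approxFiniteRank F G) (L : E →L[ℂ] F) :
    T ∘L L ∈ approxFiniteRank E G := by
  rw [approxFiniteRank, ← SetLike.mem_coe, Submodule.topologicalClosure_coe] at *
  refine map_mem_closure (f := fun T : F →L[ℂ] G => T ∘L L) (by fun_prop) hT fun S hS => ?_
  exact mem_finiteRank.2 ((mem_finiteRank.1 hS).comp_right (L : E →ₗ[ℂ] F))

open scoped LinearMap.FiniteRangeSetoid in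
/-- An invertible operator plus a norm limit of finite rank operators is Fredholm. -/
theorem isFredholm_isUnit_add [CompleteSpace E] {S K : E →L[ℂ] E} (hS : IsUnit S)
    (hK : K ∈ approxFiniteRank E E) : (S + K).IsFredholm := by
  rw [approxFiniteRank, ← SetLike.mem_coe, Submodule.topologicalClosure_coe] at hK
  -- `K` lies in this open set because `S + K - K = S`, so some finite rank `L` does too. Then `S +
  -- K` differs from the unit `S + K - L` by finite rank, and the inverse of that unit is a
  -- quasi-inverse.
  have hopen : IsOpen {L : E →L[ℂ] E | IsUnit (S + K - L)} :=
    Units.isOpen.preimage (by fun_prop : Continuous fun L : E →L[ℂ] E => S + K - L)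
  obtain ⟨L, hL, hLf⟩ := mem_closure_iff.1 hK _ hopen (by simpa using hS)
  obtain ⟨u, hu⟩ := hL
  rw [ContinuousLinearMap.isFredholm_iff_exists_isQuasiInverse]
  refine ⟨(↑u⁻¹ : E →L[ℂ] E), ?_⟩
  have h1 : LinearMap.IsQuasiInverse ((↑u⁻¹ : E →L[ℂ] E) : E →ₗ[ℂ] E) ((u : E →L[ℂ] E) : E →ₗ[ℂ] E) := by
    constructor
    · have : ((↑u⁻¹ : E →L[ℂ] E) : E →ₗ[ℂ] E) ∘ₗ ((u : E →L[ℂ] E) : E →ₗ[ℂ] E) = LinearMap.id := by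
        have := congrArg (fun T : E →L[ℂ] E => (T : E →ₗ[ℂ] E)) u.inv_mul
        exact this
      rw [LinearMap.IsLeftQuasiInverse, this]
    · have : ((u : E →L[ℂ] E) : E →ₗ[ℂ] E) ∘ₗ ((↑u⁻¹ : E →L[ℂ] E) : E →ₗ[ℂ] E) = LinearMap.id := by
        have := congrArg (fun T : E →L[ℂ] E => (T : E →ₗ[ℂ] E)) u.mul_inv
        exact this
      rw [LinearMap.IsRightQuasiInverse, this]
  refine h1.congr (Setoid.refl _) ?_
  rw [LinearMap.FiniteRangeSetoid.equiv_iff_hasFiniteRange]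
  have : ((S + K : E →L[ℂ] E) : E →ₗ[ℂ] E) - ((u : E →L[ℂ] E) : E →ₗ[ℂ] E) = L := by
    rw [hu]; ext x; simp
  rw [this]
  exact mem_finiteRank.1 hLf

end Abstract

/-! ### Compact operators and Weyl sequences in Hilbert space. -/

section Hilbert

/-- Bessel's inequality makes the squared coefficients summable. -/
theorem tendsto_inner_orthonormal {H : Type*} [NormedAddCommGroup H] [InnerProductSpace ℂ H]
    {e : ℕ → H} (he : Orthonormal ℂ e) (x : H) :
    Tendsto (fun n => inner ℂ x (e n)) atTop (𝓝 0) := by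
  have h := (he.inner_products_summable x).tendsto_atTop_zero
  rw [tendsto_zero_iff_norm_tendsto_zero]
  have h2 : Tendsto (fun n => Real.sqrt (‖inner ℂ (e n) x‖ ^ 2)) atTop (𝓝 (Real.sqrt 0)) :=
    (Real.continuous_sqrt.tendsto 0).comp h
  rw [Real.sqrt_zero] at h2
  refine h2.congr fun n => ?_
  rw [Real.sqrt_sq (norm_nonneg _), norm_inner_symm]

variable {H F : Type*} [NormedAddCommGroup H] [InnerProductSpace ℂ H] [CompleteSpace H]
  [NormedAddCommGroup F] [InnerProductSpace ℂ F]

theorem tendsto_finiteRank_orthonormal [CompleteSpace F] {T : H →L[ℂ] F}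
    (hT : T ∈ finiteRank H F) {e : ℕ → H} (he : Orthonormal ℂ e) :
    Tendsto (fun n => T (e n)) atTop (𝓝 0) := by
  have hfin : FiniteDimensional ℂ (T : H →ₗ[ℂ] F).range :=
    Module.Finite.iff_fg.2 (mem_finiteRank.1 hT)
  let b := stdOrthonormalBasis ℂ (T : H →ₗ[ℂ] F).range
  have h1 : ∀ x, T x = ∑ i, inner ℂ (ContinuousLinearMap.adjoint T (b i : F)) x • (b i : F) := by
    intro x
    have h2 := b.sum_repr' ⟨T x, ⟨x, rfl⟩⟩
    have h3 := congrArg (Subtype.val) h2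
    simp only [Submodule.coe_sum, Submodule.coe_smul, Submodule.coe_inner] at h3
    simp only [ContinuousLinearMap.adjoint_inner_left]
    exact h3.symm
  simp_rw [h1]
  rw [show (0 : F) = ∑ i, (0 : ℂ) • (b i : F) by simp]
  exact tendsto_finsetSum _ fun i _ => (tendsto_inner_orthonormal he _).smul_const _

/-- Orthonormal sequences are weakly null, and compact operators make them norm null. This is why
the localized part of the potential cannot destroy a Weyl sequence. -/
theorem tendsto_approxFiniteRank_orthonormal [CompleteSpace F] {T : H →L[ℂ] F}
    (hT : T ∈ approxFiniteRank H F) {e : ℕ → H} (he : Orthonormal ℂ e) :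
    Tendsto (fun n => T (e n)) atTop (𝓝 0) := by
  rw [Metric.tendsto_atTop]
  intro ε hε
  obtain ⟨S, hS, hTS⟩ := mem_approxFiniteRank_iff.1 hT (ε / 2) (half_pos hε)
  obtain ⟨n₀, h⟩ := Metric.tendsto_atTop.1 (tendsto_finiteRank_orthonormal hS he) (ε / 2) (half_pos hε)
  refine ⟨n₀, fun n hn => ?_⟩
  have h1 := h n hn
  rw [dist_zero_right] at *
  have h2 : ‖(T - S) (e n)‖ ≤ ‖T - S‖ := by
    simpa [he.1 n] using (T - S).le_opNorm (e n)
  calc ‖T (e n)‖ = ‖(T - S) (e n) + S (e n)‖ := by simp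
    _ ≤ ‖(T - S) (e n)‖ + ‖S (e n)‖ := norm_add_le _ _
    _ < ε := by linarith

/-- A Fredholm operator has no singular Weyl sequence at `0`. -/
theorem not_tendsto_of_isFredholm {T : H →L[ℂ] H}
    (hker : FiniteDimensional ℂ (T : H →ₗ[ℂ] H).ker)
    (hran : IsClosed ((T : H →ₗ[ℂ] H).range : Set H)) {e : ℕ → H}
    (he : Orthonormal ℂ e) : ¬ Tendsto (fun n => T (e n)) atTop (𝓝 0) := by
  intro hT
  set K : Submodule ℂ H := (T : H →ₗ[ℂ] H).ker with hK
  have hfr : K.starProjection ∈ finiteRank H H := by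
    rw [mem_finiteRank]
    have : Module.Finite ℂ ((K.starProjection : H →ₗ[ℂ] H)).range := by
      rw [Submodule.range_starProjection]; exact hker
    exact Module.Finite.iff_fg.1 this
  have hP := tendsto_finiteRank_orthonormal hfr he
  let S : Kᗮ →L[ℂ] H := T ∘L Kᗮ.subtypeL
  have hTP : ∀ x, T (Kᗮ.starProjection x) = T x := by
    intro x
    have hx := K.starProjection_add_starProjection_orthogonal x
    have h0 : T (K.starProjection x) = 0 := by
      have : K.starProjection x ∈ K := Submodule.starProjection_apply_mem K x
      exact LinearMap.mem_ker.1 this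
    conv_rhs => rw [← hx, map_add, h0, zero_add]
  have hinj : Function.Injective S := by
    rw [injective_iff_map_eq_zero]
    rintro ⟨x, hx⟩ hSx
    have hxK : x ∈ K := LinearMap.mem_ker.2 hSx
    have : x = 0 := by
      have := Submodule.mem_orthogonal K x |>.1 hx x hxK
      exact inner_self_eq_zero.1 this
    exact Subtype.ext this
  have hrange : Set.range S = ((T : H →ₗ[ℂ] H).range : Set H) := by
    ext y
    constructor
    · rintro ⟨x, rfl⟩
      exact ⟨x, rfl⟩
    · rintro ⟨x, rfl⟩
      exact ⟨⟨Kᗮ.starProjection x, Submodule.starProjection_apply_mem _ x⟩, hTP x⟩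
  -- On the orthogonal complement of its kernel `T` is injective with closed range, hence bounded
  -- below. So `T eₙ → 0` forces the complementary part of `eₙ` to `0`; the kernel part tends to `0`
  -- because the kernel is finite dimensional. This contradicts `‖eₙ‖ = 1`.
  obtain ⟨C, hC⟩ := S.antilipschitz_of_injective_of_isClosed_range hinj (hrange ▸ hran)
  have hbound : ∀ n, ‖Kᗮ.starProjection (e n)‖ ≤ C * ‖T (e n)‖ := by
    intro n
    have := hC.le_mul_norm_sub (⟨Kᗮ.starProjection (e n), Submodule.starProjection_apply_mem _ _⟩ : Kᗮ) 0
    rw [map_zero, add_zero, add_zero, norm_neg, norm_neg] at this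
    rw [show S ⟨Kᗮ.starProjection (e n), _⟩ = T (e n) from hTP _] at this
    exact this
  have hQ : Tendsto (fun n => Kᗮ.starProjection (e n)) atTop (𝓝 0) := by
    refine squeeze_zero_norm hbound ?_
    simpa using hT.norm.const_mul (C : ℝ)
  have hsum := hP.add hQ
  have h1 : Tendsto e atTop (𝓝 0) := by
    simpa [K.starProjection_add_starProjection_orthogonal] using hsum
  have h2 := h1.norm
  simp only [he.1, norm_zero] at h2
  exact one_ne_zero (tendsto_nhds_unique tendsto_const_nhds h2)

end Hilbert

/-! ### Multiplication operators and the Fourier transform on `L²` -/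

section Multiplication

variable {F : Type*} [NormedAddCommGroup F] [InnerProductSpace ℂ F] [CompleteSpace F]

/-- Multiplication by a bounded operator-valued function on `L²`. -/
def mulOp (Φ : ℝ → F →L[ℂ] F) (hΦ : MemLp Φ ∞ (volume : Measure ℝ)) :
    Lp F 2 (volume : Measure ℝ) →L[ℂ] Lp F 2 (volume : Measure ℝ) :=
  (ContinuousLinearMap.id ℂ (F →L[ℂ] F)).holderL volume ∞ 2 2 (hΦ.toLp Φ)

theorem coeFn_mulOp (Φ : ℝ → F →L[ℂ] F) (hΦ : MemLp Φ ∞ (volume : Measure ℝ))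
    (f : Lp F 2 (volume : Measure ℝ)) : mulOp Φ hΦ f =ᵐ[volume] fun t => Φ t (f t) := by
  have h := (ContinuousLinearMap.id ℂ (F →L[ℂ] F)).coeFn_holder (r := 2) (hΦ.toLp Φ) f
  have h2 := hΦ.coeFn_toLp
  filter_upwards [h, h2] with t ht ht2
  rw [mulOp, ContinuousLinearMap.holderL_apply_apply, ht, ht2]
  rfl

theorem norm_mulOp_le (Φ : ℝ → F →L[ℂ] F) (hΦ : MemLp Φ ∞ (volume : Measure ℝ)) {C : ℝ}
    (hC : 0 ≤ C) (h : ∀ t, ‖Φ t‖ ≤ C) : ‖mulOp Φ hΦ‖ ≤ C := by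
  refine ContinuousLinearMap.opNorm_le_bound _ hC fun f => ?_
  refine Lp.norm_le_mul_norm_of_ae_le_mul ?_
  filter_upwards [coeFn_mulOp Φ hΦ f] with t ht
  rw [ht]
  exact (Φ t).le_of_opNorm_le (h t) _

theorem memLp_top_of_continuous_bounded {E : Type*} [NormedAddCommGroup E] {Φ : ℝ → E}
    (hc : Continuous Φ) {C : ℝ} (h : ∀ t, ‖Φ t‖ ≤ C) : MemLp Φ ∞ (volume : Measure ℝ) :=
  memLp_top_of_bound hc.aestronglyMeasurable C (Eventually.of_forall h)

theorem mulOp_comp {Φ Ψ Θ : ℝ → F →L[ℂ] F} (hΦ : MemLp Φ ∞ (volume : Measure ℝ))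
    (hΨ : MemLp Ψ ∞ (volume : Measure ℝ)) (hΘ : MemLp Θ ∞ (volume : Measure ℝ))
    (h : ∀ t, Θ t = Φ t ∘L Ψ t) : mulOp Φ hΦ ∘L mulOp Ψ hΨ = mulOp Θ hΘ := by
  ext1 f
  apply Lp.ext
  filter_upwards [coeFn_mulOp Φ hΦ (mulOp Ψ hΨ f), coeFn_mulOp Ψ hΨ f, coeFn_mulOp Θ hΘ f]
    with t h1 h2 h3
  rw [ContinuousLinearMap.comp_apply, h1, h2, h3, h]
  rfl

theorem mulOp_add {Φ Ψ Θ : ℝ → F →L[ℂ] F} (hΦ : MemLp Φ ∞ (volume : Measure ℝ))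
    (hΨ : MemLp Ψ ∞ (volume : Measure ℝ)) (hΘ : MemLp Θ ∞ (volume : Measure ℝ))
    (h : ∀ t, Θ t = Φ t + Ψ t) : mulOp Φ hΦ + mulOp Ψ hΨ = mulOp Θ hΘ := by
  ext1 f
  apply Lp.ext
  filter_upwards [coeFn_mulOp Φ hΦ f, coeFn_mulOp Ψ hΨ f, coeFn_mulOp Θ hΘ f,
    Lp.coeFn_add (mulOp Φ hΦ f) (mulOp Ψ hΨ f)] with t h1 h2 h3 h4
  rw [add_apply, h4, Pi.add_apply, h1, h2, h3, h]
  rfl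

theorem mulOp_one (h : MemLp (fun _ => 1 : ℝ → F →L[ℂ] F) ∞ (volume : Measure ℝ)) :
    mulOp _ h = 1 := by
  ext1 f
  apply Lp.ext
  filter_upwards [coeFn_mulOp _ h f] with t h1
  rw [h1]
  rfl

end Multiplication

section Fourier

open FourierTransform

theorem integrable_schwartz_smul_Lp {F : Type*} [NormedAddCommGroup F] [NormedSpace ℂ F]
    (φ : 𝓢(ℝ, ℂ)) (f : Lp F 2 (volume : Measure ℝ)) :
    Integrable (fun x => φ x • f x) := by
  rw [← memLp_one_iff_integrable]
  exact (Lp.memLp f).smul (φ.memLp 2 volume)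

variable {F : Type*} [NormedAddCommGroup F] [InnerProductSpace ℂ F] [CompleteSpace F]

theorem Lp_ext_of_toTemperedDistribution {f g : Lp F 2 (volume : Measure ℝ)}
    (h : (f : 𝓢'(ℝ, F)) = (g : 𝓢'(ℝ, F))) : f = g :=
  LinearMap.ker_eq_bot.mp
    (Lp.ker_toTemperedDistributionCLM_eq_bot (F := F) (μ := (volume : Measure ℝ)) (p := 2)) h

/-- The Fourier transform on `L²` commutes with operators on the values. -/
theorem fourier_compLp (L : F →L[ℂ] F) (f : Lp F 2 (volume : Measure ℝ)) :
    𝓕 (L.compLpL 2 volume f) = L.compLpL 2 volume (𝓕 f) := by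
  have key : ∀ (g : Lp F 2 (volume : Measure ℝ)) (φ : 𝓢(ℝ, ℂ)),
      (L.compLpL 2 volume g : 𝓢'(ℝ, F)) φ = L ((g : 𝓢'(ℝ, F)) φ) := by
    intro g φ
    rw [Lp.toTemperedDistribution_apply, Lp.toTemperedDistribution_apply,
      ← L.integral_comp_comm (integrable_schwartz_smul_Lp φ g)]
    apply integral_congr_ae
    filter_upwards [L.coeFn_compLpL (p := 2) (μ := volume) g] with x hx
    rw [hx, map_smul]
  apply Lp_ext_of_toTemperedDistribution
  ext φ
  rw [key, ← Lp.fourier_toTemperedDistribution_eq, ← Lp.fourier_toTemperedDistribution_eq,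
    TemperedDistribution.fourier_apply, TemperedDistribution.fourier_apply, key]

/-- On `L¹ ∩ L²`, the inverse Fourier transform is given by the integral. -/
theorem coeFn_fourierInv_toLp {f : ℝ → F} (h1 : Integrable f) (h2 : MemLp f 2) :
    (𝓕⁻ (h2.toLp f) : Lp F 2 (volume : Measure ℝ)) =ᵐ[volume] 𝓕⁻ f := by
  have hL : Continuous fun p : ℝ × ℝ => (-innerₗ ℝ) p.1 p.2 :=
    (continuous_inner (𝕜 := ℝ) (E := ℝ)).neg
  have hcont : Continuous (𝓕⁻ f) := by
    exact VectorFourier.fourierIntegral_continuous Real.continuous_fourierChar hL h1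
  have hbdd : ∀ x, ‖𝓕⁻ f x‖ ≤ ∫ v, ‖f v‖ := fun x =>
    VectorFourier.norm_fourierIntegral_le_integral_norm _ _ _ f x
  have hloc : LocallyIntegrable
      (fun x => (𝓕⁻ (h2.toLp f) : Lp F 2 (volume : Measure ℝ)) x - 𝓕⁻ f x) volume :=
    ((Lp.memLp _).locallyIntegrable (by norm_num)).sub hcont.locallyIntegrable
  -- Both sides are compared against test functions: the transform moves onto the test function by
  -- the definition for distributions in `e1`, and by Fubini for the integral formula in `e2`.
  have := ae_eq_zero_of_integral_contDiff_smul_eq_zero hloc ?_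
  · filter_upwards [this] with x hx
    exact sub_eq_zero.1 hx
  intro g g_smooth g_cpt
  have hg₁ : HasCompactSupport (Complex.ofRealCLM ∘ g) := g_cpt.comp_left rfl
  have hg₂ : ContDiff ℝ (⊤ : ℕ∞) (Complex.ofRealCLM ∘ g) := by fun_prop
  set φ : 𝓢(ℝ, ℂ) := hg₁.toSchwartzMap hg₂ with hφ
  have e1 : ∫ x, φ x • (𝓕⁻ (h2.toLp f) : Lp F 2 (volume : Measure ℝ)) x = ∫ x, 𝓕⁻ φ x • f x := by
    rw [← Lp.toTemperedDistribution_apply, ← Lp.fourierInv_toTemperedDistribution_eq,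
      TemperedDistribution.fourierInv_apply, Lp.toTemperedDistribution_apply]
    apply integral_congr_ae
    filter_upwards [h2.coeFn_toLp] with x hx
    rw [hx]
  have e2 : ∫ x, 𝓕⁻ φ x • f x = ∫ x, φ x • 𝓕⁻ f x := by
    rw [SchwartzMap.fourierInv_coe]
    have h := VectorFourier.integral_fourierIntegral_smul_eq_flip (L := -innerₗ ℝ)
      Real.continuous_fourierChar hL (φ.integrable (μ := volume)) h1
    have hflip : (-innerₗ ℝ : ℝ →ₗ[ℝ] ℝ →ₗ[ℝ] ℝ).flip = -innerₗ ℝ := by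
      ext; simp
    rw [hflip] at h
    exact h
  have i1 := integrable_schwartz_smul_Lp φ (𝓕⁻ (h2.toLp f) : Lp F 2 (volume : Measure ℝ))
  have i2 : Integrable (fun x => φ x • 𝓕⁻ f x) :=
    (ContinuousLinearMap.lsmul ℂ ℂ).integrable_of_bilin_of_bdd_right _ φ.integrable
      hcont.aestronglyMeasurable (Eventually.of_forall hbdd)
  calc ∫ x, g x • ((𝓕⁻ (h2.toLp f) : Lp F 2 (volume : Measure ℝ)) x - 𝓕⁻ f x)
      = ∫ x, (φ x • (𝓕⁻ (h2.toLp f) : Lp F 2 (volume : Measure ℝ)) x - φ x • 𝓕⁻ f x) := by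
        congr 1; ext x
        rw [← smul_sub]
        simp [hφ]
    _ = 0 := by rw [integral_sub i1 i2, e1, e2, sub_self]

end Fourier

/-! ### Compactness of `W(t) m(D)` for symbols vanishing at infinity -/

section Cutoff

open FourierTransform

/-- With `z = 2πixt`, each Taylor term is a function of `t` times a function of `x`. Uniform Taylor
approximation on a disc therefore approximates the Fourier kernel on a rectangle by kernels of
finite rank. -/
theorem exists_exp_sub_sum_le (R : ℝ) {ε : ℝ} (hε : 0 < ε) :
    ∃ J : ℕ, ∀ z : ℂ, ‖z‖ ≤ R →
      ‖Complex.exp z - ∑ j ∈ Finset.range J, z ^ j / (j.factorial : ℂ)‖ ≤ ε := by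
  have h1 : ∀ᶠ n : ℕ in atTop, R ^ n / (n.factorial : ℝ) < ε / 2 :=
    (FloorSemiring.tendsto_pow_div_factorial_atTop R).eventually_lt_const (half_pos hε)
  obtain ⟨m, hm⟩ := exists_nat_ge (2 * R)
  obtain ⟨J, hJ, hmJ⟩ := (h1.and (eventually_ge_atTop m)).exists
  refine ⟨J, fun z hz => ?_⟩
  have hJm : (m : ℝ) ≤ J := by exact_mod_cast hmJ
  have h2 : ‖z‖ / (J.succ : ℝ) ≤ 1 / 2 := by
    rw [div_le_iff₀ (by positivity)]
    push_cast
    linarith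
  refine (Complex.exp_bound' h2).trans ?_
  have h3 : ‖z‖ ^ J / (J.factorial : ℝ) ≤ R ^ J / (J.factorial : ℝ) := by gcongr
  linarith

variable (F : Type*) [NormedAddCommGroup F] [InnerProductSpace ℂ F]

/-- The indicator function of `[-X, X]`, as a multiple of the identity. -/
def cutoff (X : ℝ) : ℝ → F →L[ℂ] F := (Set.Icc (-X) X).indicator fun _ => 1

theorem norm_cutoff_le (X t : ℝ) : ‖cutoff F X t‖ ≤ 1 := by
  unfold cutoff
  refine (norm_indicator_le_norm_self _ _).trans ?_
  exact ContinuousLinearMap.norm_id_le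

theorem memLp_cutoff (X : ℝ) : MemLp (cutoff F X) ∞ (volume : Measure ℝ) :=
  memLp_top_of_bound (aestronglyMeasurable_const.indicator measurableSet_Icc) 1
    (Eventually.of_forall (norm_cutoff_le F X))

variable {F}

theorem cutoff_apply (X t : ℝ) (x : F) :
    cutoff F X t x = (Set.Icc (-X) X).indicator (fun _ => x) t := by
  unfold cutoff
  by_cases h : t ∈ Set.Icc (-X) X <;> simp [h]

/-- Cauchy–Schwarz against the indicator of the interval, whose `L²` norm is `C`. -/
theorem exists_setIntegral_norm_le (X : ℝ) : ∃ C, 0 ≤ C ∧ ∀ f : Lp F 2 (volume : Measure ℝ),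
    ∫ x in Set.Icc (-X) X, ‖f x‖ ≤ C * ‖f‖ := by
  have hs : (volume : Measure ℝ) (Set.Icc (-X) X) ≠ ∞ := by simp
  refine ⟨‖indicatorConstLp 2 (measurableSet_Icc (a := -X) (b := X)) hs (1 : ℂ)‖, norm_nonneg _,
    fun f => ?_⟩
  set g := indicatorConstLp 2 (measurableSet_Icc (a := -X) (b := X)) hs (1 : ℂ)
  refine le_trans (le_of_eq ?_) (Lp.norm_smul_le (r := 1) g f)
  rw [L1.norm_eq_integral_norm, ← integral_indicator measurableSet_Icc]
  apply integral_congr_ae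
  filter_upwards [Lp.coeFn_lpSMul (r := 1) g f, indicatorConstLp_coeFn (p := 2)
    (hs := measurableSet_Icc (a := -X) (b := X)) (hμs := hs) (c := (1 : ℂ))] with x h1 h2
  rw [h1, Pi.smul_apply', h2]
  by_cases h : x ∈ Set.Icc (-X) X <;> simp [h]

variable [CompleteSpace F]

variable (F) in
/-- The Fourier transform on `L²` as an operator. -/
def fourierL2 : Lp F 2 (volume : Measure ℝ) →L[ℂ] Lp F 2 (volume : Measure ℝ) :=
  ((Lp.fourierTransformₗᵢ ℝ F).toContinuousLinearEquiv : _ →L[ℂ] _)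

variable (F) in
/-- The inverse Fourier transform on `L²` as an operator. -/
def fourierInvL2 : Lp F 2 (volume : Measure ℝ) →L[ℂ] Lp F 2 (volume : Measure ℝ) :=
  ((Lp.fourierTransformₗᵢ ℝ F).symm.toContinuousLinearEquiv : _ →L[ℂ] _)

theorem fourierInvL2_apply (f : Lp F 2 (volume : Measure ℝ)) : fourierInvL2 F f = 𝓕⁻ f := rfl

theorem coeFn_fourierInv_cutoff (X : ℝ) (f : Lp F 2 (volume : Measure ℝ)) :
    (fourierInvL2 F (mulOp _ (memLp_cutoff F X) f) : Lp F 2 (volume : Measure ℝ)) =ᵐ[volume]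
      fun t => ∫ x in Set.Icc (-X) X, Complex.exp (((2 * Real.pi * (x * t) : ℝ) : ℂ) * Complex.I) • f x := by
  have h2 : MemLp ((Set.Icc (-X) X).indicator f) 2 := (Lp.memLp f).indicator measurableSet_Icc
  have h1 : Integrable ((Set.Icc (-X) X).indicator f) := by
    rw [integrable_indicator_iff measurableSet_Icc]
    exact ((Lp.memLp f).locallyIntegrable (by norm_num)).integrableOn_isCompact isCompact_Icc
  have h3 : mulOp _ (memLp_cutoff F X) f = h2.toLp _ := by
    apply Lp.ext
    filter_upwards [coeFn_mulOp _ (memLp_cutoff F X) f, h2.coeFn_toLp] with x hx hx2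
    rw [hx, hx2, cutoff_apply]
    by_cases h : x ∈ Set.Icc (-X) X <;> simp [h]
  rw [h3, fourierInvL2_apply]
  filter_upwards [coeFn_fourierInv_toLp h1 h2] with t ht
  rw [ht, Real.fourierInv_eq', ← integral_indicator measurableSet_Icc]
  congr 1
  ext x
  by_cases h : x ∈ Set.Icc (-X) X <;> simp [h, mul_comm]

theorem memLp_indicator_continuous {T : ℝ} {g : ℝ → ℂ} (hg : Continuous g) :
    MemLp ((Set.Icc (-T) T).indicator g) 2 (volume : Measure ℝ) := by
  rw [memLp_indicator_iff_restrict measurableSet_Icc]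
  obtain ⟨C, hC⟩ := isCompact_Icc.exists_bound_of_continuousOn (s := Set.Icc (-T) T) hg.continuousOn
  exact MemLp.of_bound hg.aestronglyMeasurable C
    ((ae_restrict_iff' measurableSet_Icc).2 (Eventually.of_forall hC))

/-- The rank-`dim F` operator `f ↦ a • ∫ b • f`. -/
def separatedOp (a b : Lp ℂ 2 (volume : Measure ℝ)) :
    Lp F 2 (volume : Measure ℝ) →L[ℂ] Lp F 2 (volume : Measure ℝ) :=
  ((ContinuousLinearMap.compLpL₂ 2 volume (ContinuousLinearMap.lsmul ℂ ℂ (E := F)).flip).flip a) ∘L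
    ((ContinuousLinearMap.lsmul ℂ ℂ (E := F)).lpPairing volume 2 2 b)

theorem coeFn_separatedOp (a b : Lp ℂ 2 (volume : Measure ℝ)) (f : Lp F 2 (volume : Measure ℝ)) :
    separatedOp a b f =ᵐ[volume] fun t => a t • ∫ x, b x • f x := by
  have h : ∀ w : F, ((ContinuousLinearMap.lsmul ℂ ℂ (E := F)).flip w).compLp a =ᵐ[volume]
      fun t => a t • w := fun w => ContinuousLinearMap.coeFn_compLp _ _
  refine (h _).trans (Eventually.of_forall fun t => congrArg (a t • ·) ?_)
  exact (ContinuousLinearMap.lsmul ℂ ℂ (E := F)).lpPairing_eq_integral b f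

theorem separatedOp_mem_finiteRank [FiniteDimensional ℂ F] (a b : Lp ℂ 2 (volume : Measure ℝ)) :
    (separatedOp a b : Lp F 2 (volume : Measure ℝ) →L[ℂ] Lp F 2 (volume : Measure ℝ)) ∈
      finiteRank _ _ := by
  rw [mem_finiteRank]
  exact LinearMap.HasFiniteRange.comp_right (LinearMap.HasFiniteRange.of_finite_dom (K := ℂ)
    (f := ((ContinuousLinearMap.compLpL₂ 2 volume
      (ContinuousLinearMap.lsmul ℂ ℂ (E := F)).flip).flip a).toLinearMap)) _

/-- The operator has kernel `e^{2πixt}` on the rectangle `[-T, T] × [-X, X]`, and truncating the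
exponential series yields a finite sum of `separatedOp`s close to it in norm. -/
theorem cutoff_fourierInv_cutoff_mem [FiniteDimensional ℂ F] (T X : ℝ) :
    mulOp _ (memLp_cutoff F T) ∘L fourierInvL2 F ∘L mulOp _ (memLp_cutoff F X) ∈
      approxFiniteRank (Lp F 2 (volume : Measure ℝ)) (Lp F 2 (volume : Measure ℝ)) := by
  apply mem_approxFiniteRank_of_forall_norm_sub_le
  intro ε hε
  obtain ⟨C, hC0, hC⟩ := exists_setIntegral_norm_le (F := F) X
  have hTfin : (volume : Measure ℝ) (Set.Icc (-T) T) ≠ ∞ := by simp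
  set D : ℝ := ‖indicatorConstLp 2 (measurableSet_Icc (a := -T) (b := T)) hTfin (1 : ℝ)‖ with hD
  have hD0 : 0 ≤ D := norm_nonneg _
  -- A pointwise kernel error `δ` costs at most `δ C D` in operator norm; the `+ 1` keeps the
  -- denominator positive.
  set δ : ℝ := ε / (C * D + 1) with hδ
  have hδ0 : 0 < δ := by positivity
  obtain ⟨J, hJ⟩ := exists_exp_sub_sum_le (2 * Real.pi * (X * T)) hδ0
  let g : ℕ → ℝ → ℂ := fun j t => (2 * Real.pi * Complex.I * t) ^ j / (j.factorial : ℂ)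
  have hg : ∀ j, Continuous (g j) := fun j => by fun_prop
  let q : ℕ → ℝ → ℂ := fun j x => (x : ℂ) ^ j
  have hq : ∀ j, Continuous (q j) := fun j => by fun_prop
  let a : ℕ → Lp ℂ 2 (volume : Measure ℝ) := fun j =>
    (memLp_indicator_continuous (T := T) (hg j)).toLp
  let b : ℕ → Lp ℂ 2 (volume : Measure ℝ) := fun j =>
    (memLp_indicator_continuous (T := X) (hq j)).toLp
  refine ⟨∑ j ∈ Finset.range J, separatedOp (a j) (b j),
    Submodule.le_topologicalClosure _ (Submodule.sum_mem _ fun j _ =>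
      separatedOp_mem_finiteRank (a j) (b j)), ?_⟩
  refine ContinuousLinearMap.opNorm_le_bound _ hε.le fun f => ?_
  have hfint : IntegrableOn f (Set.Icc (-X) X) :=
    ((Lp.memLp f).locallyIntegrable (by norm_num)).integrableOn_isCompact isCompact_Icc
  have hb : ∀ j, ∫ x, b j x • f x = ∫ x in Set.Icc (-X) X, q j x • f x := by
    intro j
    rw [← integral_indicator measurableSet_Icc]
    apply integral_congr_ae
    filter_upwards [(memLp_indicator_continuous (T := X) (hq j)).coeFn_toLp] with x hx
    rw [hx]
    by_cases h : x ∈ Set.Icc (-X) X <;> simp [h]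
  set A : Lp F 2 (volume : Measure ℝ) →L[ℂ] Lp F 2 (volume : Measure ℝ) :=
    mulOp _ (memLp_cutoff F T) ∘L fourierInvL2 F ∘L mulOp _ (memLp_cutoff F X) -
      ∑ j ∈ Finset.range J, separatedOp (a j) (b j) with hA
  have hae : ∀ᵐ t ∂(volume : Measure ℝ),
      ‖(A f : Lp F 2 (volume : Measure ℝ)) t‖ ≤
      ‖(δ * (C * ‖f‖)) • (indicatorConstLp 2 (measurableSet_Icc (a := -T) (b := T)) hTfin (1 : ℝ) : ℝ → ℝ) t‖ := by
    have hall : ∀ᵐ t ∂(volume : Measure ℝ), ∀ j, separatedOp (a j) (b j) f t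
        = (Set.Icc (-T) T).indicator (g j) t • ∫ x in Set.Icc (-X) X, q j x • f x := by
      rw [ae_all_iff]
      intro j
      filter_upwards [coeFn_separatedOp (a j) (b j) f,
        (memLp_indicator_continuous (T := T) (hg j)).coeFn_toLp] with t h1 h2
      rw [h1, hb, h2]
    filter_upwards [hall, coeFn_mulOp _ (memLp_cutoff F T)
      (fourierInvL2 F (mulOp _ (memLp_cutoff F X) f)), coeFn_fourierInv_cutoff X f,
      Lp.coeFn_sub (mulOp _ (memLp_cutoff F T) (fourierInvL2 F (mulOp _ (memLp_cutoff F X) f)))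
        (∑ j ∈ Finset.range J, separatedOp (a j) (b j) f),
      Lp.coeFn_finsetSum (Finset.range J) (fun j => separatedOp (a j) (b j) f),
      indicatorConstLp_coeFn (p := 2) (hs := measurableSet_Icc (a := -T) (b := T)) (hμs := hTfin)
        (c := (1 : ℝ))] with t h1 h2 h3 h4 h5 h6
    rw [hA, sub_apply, sum_apply, ContinuousLinearMap.comp_apply,
      ContinuousLinearMap.comp_apply, h4, Pi.sub_apply, h2, h5, Finset.sum_apply, h6, cutoff_apply,
      h3]
    simp_rw [h1]
    by_cases ht : t ∈ Set.Icc (-T) T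
    · simp only [Set.indicator_of_mem ht]
      have hX : 0 ≤ C * ‖f‖ := by positivity
      rw [smul_eq_mul, mul_one, Real.norm_of_nonneg (by positivity)]
      have hint : ∀ k : ℝ → ℂ, Continuous k → IntegrableOn (fun x => k x • f x) (Set.Icc (-X) X) := by
        intro k hk
        exact hfint.continuousOn_smul hk.continuousOn isCompact_Icc
      simp_rw [← integral_smul]
      have hsm : ∀ j, Integrable (fun x => g j t • q j x • f x)
          (volume.restrict (Set.Icc (-X) X)) := fun j => (hint _ (hq j)).smul (g j t)
      rw [← integral_finsetSum _ fun j _ => hsm j,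
        ← integral_sub (hint _ (by fun_prop)) (integrable_finsetSum _ fun j _ => hsm j)]
      calc _ ≤ ∫ x in Set.Icc (-X) X, δ * ‖f x‖ := by
            refine norm_integral_le_of_norm_le (hfint.norm.const_mul δ) ?_
            refine (ae_restrict_iff' measurableSet_Icc).2 (Eventually.of_forall fun x hx => ?_)
            simp_rw [smul_smul]
            rw [← Finset.sum_smul, ← sub_smul, norm_smul]
            refine mul_le_mul_of_nonneg_right ?_ (norm_nonneg _)
            have hz : ‖((2 * Real.pi * (x * t) : ℝ) : ℂ) * Complex.I‖ ≤ 2 * Real.pi * (X * T) := by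
              rw [norm_mul, Complex.norm_I, mul_one, Complex.norm_real, Real.norm_eq_abs, abs_mul,
                abs_of_pos Real.two_pi_pos, abs_mul]
              have hx' := abs_le.2 ⟨hx.1, hx.2⟩
              have ht' := abs_le.2 ⟨ht.1, ht.2⟩
              have := mul_le_mul hx' ht' (abs_nonneg _) ((abs_nonneg _).trans hx')
              exact mul_le_mul_of_nonneg_left this Real.two_pi_pos.le
            refine le_trans (le_of_eq ?_) (hJ _ hz)
            congr 2
            refine Finset.sum_congr rfl fun j _ => ?_
            simp only [g, q]
            push_cast
            rw [div_mul_eq_mul_div, ← mul_pow]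
            congr 2
            ring
        _ = δ * ∫ x in Set.Icc (-X) X, ‖f x‖ := integral_const_mul _ _
        _ ≤ δ * (C * ‖f‖) := by gcongr; exact hC f
    · simp [ht]
  have hle := Lp.norm_le_norm_of_ae_le (f := A f)
    (g := (δ * (C * ‖f‖)) • indicatorConstLp 2 (measurableSet_Icc (a := -T) (b := T)) hTfin (1 : ℝ))
    (by
      filter_upwards [hae, Lp.coeFn_smul (δ * (C * ‖f‖))
        (indicatorConstLp 2 (measurableSet_Icc (a := -T) (b := T)) hTfin (1 : ℝ))] with t h1 h2
      rw [h2]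
      exact h1)
  refine hle.trans ?_
  rw [norm_smul, Real.norm_of_nonneg (by positivity), ← hD]
  have : δ * (C * ‖f‖) * D = (δ * (C * D)) * ‖f‖ := by ring
  rw [this]
  refine mul_le_mul_of_nonneg_right ?_ (norm_nonneg _)
  rw [hδ, div_mul_eq_mul_div, div_le_iff₀ (by positivity)]
  nlinarith

end Cutoff

/-! ### Continuous symbols with a limit at infinity. -/

section Symbols

variable {F : Type*} [NormedAddCommGroup F] [InnerProductSpace ℂ F]

theorem exists_bound_of_tendsto_cocompact {E : Type*} [NormedAddCommGroup E] {Φ : ℝ → E} {a : E}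
    (hc : Continuous Φ) (h : Tendsto Φ (cocompact ℝ) (𝓝 a)) : ∃ C, ∀ t, ‖Φ t‖ ≤ C := by
  have hd : Tendsto (fun t => Φ t - a) (cocompact ℝ) (𝓝 0) := by
    simpa using h.sub_const a
  obtain ⟨R, hR⟩ := (Metric.isBounded_iff_subset_closedBall (0 : E)).mp
    (ZeroAtInftyContinuousMap.isBounded_range
      (⟨⟨fun t => Φ t - a, hc.sub continuous_const⟩, hd⟩ : ZeroAtInftyContinuousMap ℝ E))
  refine ⟨R + ‖a‖, fun t => ?_⟩
  have h1 : ‖Φ t - a‖ ≤ R := mem_closedBall_zero_iff.1 (hR (Set.mem_range_self t))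
  calc ‖Φ t‖ = ‖(Φ t - a) + a‖ := by rw [sub_add_cancel]
    _ ≤ R + ‖a‖ := (norm_add_le _ _).trans (by gcongr)

theorem memLp_top_of_tendsto_cocompact {E : Type*} [NormedAddCommGroup E] {Φ : ℝ → E} {a : E}
    (hc : Continuous Φ) (h : Tendsto Φ (cocompact ℝ) (𝓝 a)) :
    MemLp Φ ∞ (volume : Measure ℝ) :=
  memLp_top_of_continuous_bounded hc (exists_bound_of_tendsto_cocompact hc h).choose_spec

theorem exists_forall_norm_le_of_notMem_Icc {E : Type*} [NormedAddCommGroup E] {Φ : ℝ → E}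
    (h : Tendsto Φ (cocompact ℝ) (𝓝 0)) {ε : ℝ} (hε : 0 < ε) :
    ∃ n₀ : ℕ, ∀ n ≥ n₀, ∀ t ∉ Set.Icc (-(n : ℝ)) n, ‖Φ t‖ ≤ ε := by
  have h1 : ∀ᶠ t in cocompact ℝ, ‖Φ t‖ < ε := by
    have := h.norm
    rw [norm_zero] at this
    exact this.eventually_lt_const hε
  obtain ⟨s, hs, hsub⟩ := mem_cocompact.1 h1
  obtain ⟨R, hR⟩ := hs.isBounded.subset_closedBall (0 : ℝ)
  obtain ⟨n₀, hn⟩ := exists_nat_ge R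
  refine ⟨n₀, fun n hnn t ht => le_of_lt (hsub fun hts => ht ?_)⟩
  have h2 := mem_closedBall_zero_iff.1 (hR hts)
  have h3 : (n₀ : ℝ) ≤ n := by exact_mod_cast hnn
  rw [Real.norm_eq_abs] at h2
  exact abs_le.1 (h2.trans (hn.trans h3))

variable [CompleteSpace F]

theorem norm_mulOp_sub_le {Φ Ψ : ℝ → F →L[ℂ] F} (hΦ : MemLp Φ ∞ (volume : Measure ℝ))
    (hΨ : MemLp Ψ ∞ (volume : Measure ℝ)) {C : ℝ} (hC : 0 ≤ C) (h : ∀ t, ‖Φ t - Ψ t‖ ≤ C) :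
    ‖mulOp Φ hΦ - mulOp Ψ hΨ‖ ≤ C := by
  have h1 : mulOp Φ hΦ - mulOp Ψ hΨ = mulOp (fun t => Φ t - Ψ t) (hΦ.sub hΨ) := by
    rw [sub_eq_iff_eq_add, mulOp_add _ _ hΦ fun t => (sub_add_cancel (Φ t) (Ψ t)).symm]
  rw [h1]
  exact norm_mulOp_le _ _ hC h

/-- The error is multiplication by `Φ` outside `[-n, n]`, whose norm is at most the supremum of
`‖Φ‖` there. -/
theorem tendsto_mulOp_cutoff {Φ : ℝ → F →L[ℂ] F} (hΦ : MemLp Φ ∞ (volume : Measure ℝ))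
    (h : Tendsto Φ (cocompact ℝ) (𝓝 0)) :
    Tendsto (fun n : ℕ => mulOp Φ hΦ ∘L mulOp _ (memLp_cutoff F n)) atTop (𝓝 (mulOp Φ hΦ)) ∧
    Tendsto (fun n : ℕ => mulOp _ (memLp_cutoff F n) ∘L mulOp Φ hΦ) atTop (𝓝 (mulOp Φ hΦ)) := by
  have hind : ∀ n : ℕ, MemLp ((Set.Icc (-(n : ℝ)) n).indicator Φ) ∞ (volume : Measure ℝ) :=
    fun n => hΦ.indicator measurableSet_Icc
  have hlim : Tendsto (fun n : ℕ => mulOp _ (hind n)) atTop (𝓝 (mulOp Φ hΦ)) := by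
    rw [Metric.tendsto_atTop]
    intro ε hε
    obtain ⟨n₀, hn₀⟩ := exists_forall_norm_le_of_notMem_Icc h (half_pos hε)
    refine ⟨n₀, fun n hn => ?_⟩
    rw [dist_eq_norm_sub]
    refine lt_of_le_of_lt (norm_mulOp_sub_le _ _ (half_pos hε).le fun t => ?_) (half_lt_self hε)
    by_cases ht : t ∈ Set.Icc (-(n : ℝ)) n
    · simp [ht, (half_pos hε).le]
    · simpa [ht] using hn₀ n hn t ht
  constructor
  · refine hlim.congr fun n => (mulOp_comp hΦ (memLp_cutoff F n) (hind n) fun t => ?_).symm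
    by_cases ht : t ∈ Set.Icc (-(n : ℝ)) n <;> ext x <;> simp [cutoff_apply, ht]
  · refine hlim.congr fun n => (mulOp_comp (memLp_cutoff F n) hΦ (hind n) fun t => ?_).symm
    by_cases ht : t ∈ Set.Icc (-(n : ℝ)) n <;> ext x <;> simp [cutoff_apply, ht]

/-- Operators `Φ(t) Ψ(D)` with `Φ` and `Ψ` vanishing at infinity are norm limits of finite rank
operators. -/
theorem mulOp_fourierInv_mulOp_mem [FiniteDimensional ℂ F] {Φ Ψ : ℝ → F →L[ℂ] F}
    (hΦ : MemLp Φ ∞ (volume : Measure ℝ)) (hΨ : MemLp Ψ ∞ (volume : Measure ℝ))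
    (h1 : Tendsto Φ (cocompact ℝ) (𝓝 0)) (h2 : Tendsto Ψ (cocompact ℝ) (𝓝 0)) :
    mulOp Φ hΦ ∘L fourierInvL2 F ∘L mulOp Ψ hΨ ∈
      approxFiniteRank (Lp F 2 (volume : Measure ℝ)) (Lp F 2 (volume : Measure ℝ)) := by
  have hc : IsClosed (approxFiniteRank (Lp F 2 (volume : Measure ℝ)) (Lp F 2 (volume : Measure ℝ)) :
    Set (Lp F 2 (volume : Measure ℝ) →L[ℂ] Lp F 2 (volume : Measure ℝ))) :=
    Submodule.isClosed_topologicalClosure _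
  have hA := (tendsto_mulOp_cutoff hΦ h1).1
  have hB := (tendsto_mulOp_cutoff hΨ h2).2
  have hAB : Tendsto (fun n : ℕ => (mulOp Φ hΦ ∘L mulOp _ (memLp_cutoff F n)) ∘L fourierInvL2 F ∘L
      (mulOp _ (memLp_cutoff F n) ∘L mulOp Ψ hΨ)) atTop
      (𝓝 (mulOp Φ hΦ ∘L fourierInvL2 F ∘L mulOp Ψ hΨ)) :=
    hA.mul (hB.const_mul (fourierInvL2 F))
  refine hc.mem_of_tendsto hAB (Eventually.of_forall fun n => ?_)
  exact comp_mem_approxFiniteRank (mem_approxFiniteRank_comp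
    (cutoff_fourierInv_cutoff_mem (F := F) n n) (mulOp Ψ hΨ)) (mulOp Φ hΦ)

/-- Multiplication by a continuous function with invertible values and an invertible limit at
infinity is invertible. -/
theorem isUnit_mulOp {Φ : ℝ → F →L[ℂ] F} {a : F →L[ℂ] F} (hc : Continuous Φ)
    (hΦ : MemLp Φ ∞ (volume : Measure ℝ)) (h : Tendsto Φ (cocompact ℝ) (𝓝 a)) (ha : IsUnit a)
    (hu : ∀ t, IsUnit (Φ t)) : IsUnit (mulOp Φ hΦ) := by
  set Θ : ℝ → F →L[ℂ] F := fun t => Ring.inverse (Φ t) with hΘ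
  have hinv : ∀ {b : F →L[ℂ] F}, IsUnit b → ContinuousAt Ring.inverse b := by
    rintro _ ⟨u, rfl⟩
    exact NormedRing.inverse_continuousAt u
  have hcΘ : Continuous Θ := continuous_iff_continuousAt.2 fun t =>
    (hinv (hu t)).comp hc.continuousAt
  -- Invertibility of the limit `a` is what keeps the pointwise inverses bounded.
  have hlim : Tendsto Θ (cocompact ℝ) (𝓝 (Ring.inverse a)) := (hinv ha).tendsto.comp h
  have hmem := memLp_top_of_tendsto_cocompact hcΘ hlim
  have hone : MemLp (fun _ => 1 : ℝ → F →L[ℂ] F) ∞ (volume : Measure ℝ) :=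
    memLp_top_of_continuous_bounded continuous_const (C := ‖(1 : F →L[ℂ] F)‖) fun _ => le_rfl
  refine ⟨⟨mulOp Φ hΦ, mulOp Θ hmem, ?_, ?_⟩, rfl⟩
  · rw [← mulOp_one hone]
    exact mulOp_comp hΦ hmem hone fun t => (Ring.mul_inverse_cancel _ (hu t)).symm
  · rw [← mulOp_one hone]
    exact mulOp_comp hmem hΦ hone fun t => (Ring.inverse_mul_cancel _ (hu t)).symm

/-- If a continuous symbol is not injective at a point, the multiplication operator has a singular
Weyl sequence at `0`. -/
theorem exists_orthonormal_tendsto_mulOp {Φ : ℝ → F →L[ℂ] F} (hc : Continuous Φ)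
    (hΦ : MemLp Φ ∞ (volume : Measure ℝ)) {x₀ : ℝ} {w : F} (hw : ‖w‖ = 1) (h0 : Φ x₀ w = 0) :
    ∃ e : ℕ → Lp F 2 (volume : Measure ℝ), Orthonormal ℂ e ∧
      Tendsto (fun n => mulOp Φ hΦ (e n)) atTop (𝓝 0) := by
  -- The intervals `(x₀ + p (n+1), x₀ + p n]` are disjoint and shrink to `x₀`. Their indicators
  -- times `w`, normalized in `L²`, are orthonormal, and `Φ x w` is small on them by continuity.
  let p : ℕ → ℝ := fun n => 1 / ((n : ℝ) + 1)
  have hp : ∀ n, p (n + 1) < p n := fun n => by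
    simp only [p]
    apply one_div_lt_one_div_of_lt
    · positivity
    · push_cast; linarith
  have hanti : StrictAnti p := strictAnti_nat_of_succ_lt hp
  let s : ℕ → Set ℝ := fun n => Set.Ioc (x₀ + p (n + 1)) (x₀ + p n)
  have hsm : ∀ n, MeasurableSet (s n) := fun n => measurableSet_Ioc
  have hsfin : ∀ n, (volume : Measure ℝ) (s n) ≠ ∞ := fun n => by simp [s]
  have hvol : ∀ n, (volume : Measure ℝ).real (s n) = p n - p (n + 1) := fun n => by
    simp only [s, Real.volume_real_Ioc, add_sub_add_left_eq_sub]
    exact max_eq_left (sub_nonneg.2 (hp n).le)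
  let c : ℕ → ℝ := fun n => (Real.sqrt (p n - p (n + 1)))⁻¹
  let e : ℕ → Lp F 2 (volume : Measure ℝ) := fun n =>
    indicatorConstLp 2 (hsm n) (hsfin n) ((c n : ℂ) • w)
  have horth : Orthonormal ℂ e := by
    rw [orthonormal_iff_ite]
    intro i j
    simp only [e]
    rw [L2.inner_indicatorConstLp_indicatorConstLp (hs := hsm i) (ht := hsm j) (hμs := hsfin i)
      (hμt := hsfin j)]
    by_cases hij : i = j
    · subst hij
      rw [Set.inter_self, hvol, inner_self_eq_norm_sq_to_K, norm_smul, hw, if_pos rfl]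
      have hpos : 0 < p i - p (i + 1) := sub_pos.2 (hp i)
      have h1 : (p i - p (i + 1)) * c i ^ 2 = 1 := by
        simp only [c]
        rw [inv_pow, Real.sq_sqrt hpos.le, mul_inv_cancel₀ hpos.ne']
      rw [mul_one, Complex.norm_real, Real.norm_eq_abs, Complex.real_smul]
      have h2 : |c i| ^ 2 = c i ^ 2 := sq_abs _
      have h3 : ((p i - p (i + 1) : ℝ) : ℂ) * ((|c i| : ℝ) : ℂ) ^ 2 = 1 := by
        rw [← Complex.ofReal_pow, ← Complex.ofReal_mul, h2, h1, Complex.ofReal_one]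
      exact h3
    · have hdis : s i ∩ s j = ∅ := by
        rw [← Set.disjoint_iff_inter_eq_empty, Set.disjoint_left]
        rintro x ⟨hx1, hx2⟩ ⟨hx3, hx4⟩
        rcases lt_or_gt_of_ne hij with h | h
        · have := hanti.antitone (Nat.succ_le_of_lt h)
          simp only [Nat.succ_eq_add_one] at this
          linarith
        · have := hanti.antitone (Nat.succ_le_of_lt h)
          simp only [Nat.succ_eq_add_one] at this
          linarith
      rw [hdis, if_neg hij]
      simp
  refine ⟨e, horth, ?_⟩
  rw [Metric.tendsto_atTop]
  intro ε hε
  have hcw : Tendsto (fun x => ‖Φ x w‖) (𝓝 x₀) (𝓝 0) := by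
    have : Continuous fun x => ‖Φ x w‖ := by fun_prop
    simpa [h0] using this.tendsto x₀
  obtain ⟨δ, hδ, hball⟩ := Metric.eventually_nhds_iff.1 (hcw.eventually_lt_const (half_pos hε))
  obtain ⟨n₀, hn₀⟩ := (tendsto_one_div_add_atTop_nhds_zero_nat (𝕜 := ℝ)).eventually_lt_const hδ |>.exists
  refine ⟨n₀, fun n hn => ?_⟩
  rw [dist_zero_right]
  have hbound : ‖mulOp Φ hΦ (e n)‖ ≤ ε / 2 * ‖e n‖ := by
    refine Lp.norm_le_mul_norm_of_ae_le_mul ?_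
    filter_upwards [coeFn_mulOp Φ hΦ (e n), indicatorConstLp_coeFn (p := 2) (hs := hsm n)
      (hμs := hsfin n) (c := (c n : ℂ) • w)] with x h1 h2
    rw [h1, h2]
    by_cases hx : x ∈ s n
    · rw [Set.indicator_of_mem hx, map_smul, norm_smul, norm_smul, hw, mul_one, mul_comm]
      refine mul_le_mul_of_nonneg_right (hball ?_).le (norm_nonneg _)
      rw [Real.dist_eq, abs_lt]
      have h3 : p n ≤ p n₀ := hanti.antitone hn
      have h4 : 0 < p (n + 1) := by simp only [p]; positivity
      have h5 : p n₀ < δ := hn₀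
      constructor <;> linarith [hx.1, hx.2]
    · simp [hx]
  rw [horth.1 n] at hbound
  linarith

end Symbols

/-! ### The linearization in Fourier variables -/

section Sobolev

open FourierTransform TemperedDistribution

variable {N : ℕ} [NeZero N]

theorem smulLeftCLM_toTemperedDistribution {p : ℝ → ℂ} (hp : p.HasTemperateGrowth) {f g : L2 N}
    (h : g =ᵐ[volume] fun x => p x • f x) :
    smulLeftCLM (Vec N) p (f : 𝓢'(ℝ, Vec N)) = (g : 𝓢'(ℝ, Vec N)) := by
  ext1 φ
  rw [smulLeftCLM_apply_apply, Lp.toTemperedDistribution_apply, Lp.toTemperedDistribution_apply]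
  apply integral_congr_ae
  filter_upwards [h] with x hx
  rw [hx, SchwartzMap.smulLeftCLM_apply_apply hp, smul_smul, smul_eq_mul, mul_comm]

/-- The symbol `(1 + x²)⁻¹` of the inverse Bessel potential of order two. -/
def besselSymbol (x : ℝ) : ℂ := (((1 + x ^ 2)⁻¹ : ℝ) : ℂ)

theorem besselSymbol_eq (x : ℝ) :
    (((1 + ‖x‖ ^ 2) ^ ((-2 : ℝ) / 2) : ℝ) : ℂ) = besselSymbol x := by
  rw [besselSymbol, show (-2 : ℝ) / 2 = -1 by norm_num, Real.rpow_neg_one, Real.norm_eq_abs, sq_abs]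

theorem continuous_besselSymbol : Continuous besselSymbol := by
  unfold besselSymbol
  refine Complex.continuous_ofReal.comp (Continuous.inv₀ (by fun_prop) fun x => by positivity)

theorem tendsto_besselSymbol : Tendsto besselSymbol (cocompact ℝ) (𝓝 0) := by
  have h1 : Tendsto (fun x : ℝ => 1 + x ^ 2) (cocompact ℝ) atTop := by
    refine tendsto_atTop_add_const_left _ _ ?_
    have h2 := (tendsto_pow_atTop (α := ℝ) two_ne_zero).comp (tendsto_norm_cocompact_atTop (E := ℝ))
    refine h2.congr fun x => ?_
    simp
  have h3 := (Complex.continuous_ofReal.tendsto 0).comp (tendsto_inv_atTop_zero.comp h1)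
  rw [Complex.ofReal_zero] at h3
  exact h3

theorem ofReal_one_add_sq_ne_zero (x : ℝ) : ((1 : ℂ) + (x : ℂ) ^ 2) ≠ 0 := by
  have h : ((1 + x ^ 2 : ℝ) : ℂ) ≠ 0 := Complex.ofReal_ne_zero.2 (by positivity)
  simpa using h

variable (N) in
/-- The affine symbol `A + (1 + x²)⁻¹ B`. -/
def affineSymbol (A B : Vec N →L[ℂ] Vec N) (x : ℝ) : Vec N →L[ℂ] Vec N :=
  A + besselSymbol x • B

theorem continuous_affineSymbol (A B : Vec N →L[ℂ] Vec N) : Continuous (affineSymbol N A B) :=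
  continuous_const.add (continuous_besselSymbol.smul continuous_const)

theorem tendsto_affineSymbol (A B : Vec N →L[ℂ] Vec N) :
    Tendsto (affineSymbol N A B) (cocompact ℝ) (𝓝 A) := by
  have := (tendsto_besselSymbol.smul_const B).const_add A
  have h0 : (0 : ℂ) • B = 0 := zero_smul ℂ B
  rw [h0, add_zero] at this
  exact this

theorem memLp_affineSymbol (A B : Vec N →L[ℂ] Vec N) :
    MemLp (affineSymbol N A B) ∞ (volume : Measure ℝ) :=
  memLp_top_of_tendsto_cocompact (continuous_affineSymbol A B) (tendsto_affineSymbol A B)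

/-- Multiplication by the affine symbol `A + (1 + x²)⁻¹ B` in Fourier variables. -/
def affineMul (A B : Vec N →L[ℂ] Vec N) : L2 N →L[ℂ] L2 N :=
  mulOp (affineSymbol N A B) (memLp_affineSymbol A B)

theorem coeFn_affineMul (A B : Vec N →L[ℂ] Vec N) (f : L2 N) :
    affineMul A B f =ᵐ[volume] fun x => A (f x) + besselSymbol x • B (f x) := by
  filter_upwards [coeFn_mulOp _ (memLp_affineSymbol A B) f] with x hx
  rw [affineMul, hx]
  simp [affineSymbol]

variable (N) in
/-- The inverse of the Bessel potential of order two, `L² → L²`. -/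
def besselInv : L2 N →L[ℂ] L2 N :=
  fourierInvL2 (Vec N) ∘L affineMul 0 1 ∘L fourierL2 (Vec N)

theorem fourier_besselInv (g : L2 N) : 𝓕 (besselInv N g) = affineMul 0 1 (𝓕 g) :=
  (Lp.fourierTransformₗᵢ ℝ (Vec N)).apply_symm_apply _

theorem hasTemperateGrowth_besselSymbol :
    Function.HasTemperateGrowth
      (fun x : ℝ => (((1 + ‖x‖ ^ 2) ^ ((-2 : ℝ) / 2) : ℝ) : ℂ)) := by
  fun_prop

/-- Links the distributional Bessel potential, through which `H²` is defined, with the bounded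
multiplier on `L²`. -/
theorem besselPotential_neg_two_eq (g : L2 N) :
    besselPotential ℝ (Vec N) (-2) (g : 𝓢'(ℝ, Vec N)) = (besselInv N g : 𝓢'(ℝ, Vec N)) := by
  have hinj : Function.Injective (𝓕 : 𝓢'(ℝ, Vec N) → 𝓢'(ℝ, Vec N)) :=
    Function.LeftInverse.injective fourierInv_fourier_eq
  apply hinj
  rw [fourier_besselPotential_eq_smulLeftCLM_fourier_apply, Lp.fourier_toTemperedDistribution_eq,
    Lp.fourier_toTemperedDistribution_eq, fourier_besselInv]
  apply smulLeftCLM_toTemperedDistribution hasTemperateGrowth_besselSymbol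
  filter_upwards [coeFn_affineMul 0 1 (𝓕 g)] with x hx
  rw [hx, besselSymbol_eq]
  simp

theorem besselPotential_two_besselInv (g : L2 N) :
    besselPotential ℝ (Vec N) 2 (besselInv N g : 𝓢'(ℝ, Vec N)) = (g : 𝓢'(ℝ, Vec N)) :=
  (besselPotential_neg_apply_eq_iff 2 _ _).1 (besselPotential_neg_two_eq g)

theorem besselInv_mem (g : L2 N) : besselInv N g ∈ H2 N :=
  ⟨g, besselPotential_two_besselInv g⟩

variable (N) in
/-- The inverse Bessel potential as a linear bijection from `L²` onto `H²`. -/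
def besselEquiv : L2 N ≃ₗ[ℂ] H2 N :=
  LinearEquiv.ofBijective ((besselInv N : L2 N →ₗ[ℂ] L2 N).codRestrict (H2 N) besselInv_mem) <| by
    constructor
    · intro g g' h
      have h1 : besselInv N g = besselInv N g' := congrArg Subtype.val h
      apply toTemperedDistribution_inj
      rw [← besselPotential_two_besselInv g, h1, besselPotential_two_besselInv g']
    · rintro ⟨f, g, hg⟩
      refine ⟨g, Subtype.ext (toTemperedDistribution_inj ?_)⟩
      have h := (besselPotential_neg_apply_eq_iff 2 _ _).2 hg
      rw [besselPotential_neg_two_eq] at h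
      exact h

/-- `∂ₜ²` has symbol `-4π²x²`, and `-4π²x² / (1 + x²) = -4π² + 4π² / (1 + x²)`, so affine symbols in
`(1 + x²)⁻¹` suffice. -/
theorem fourier_secondDeriv_besselEquiv (g : L2 N) :
    𝓕 (secondDeriv N (besselEquiv N g)) =
      affineMul (-(4 * Real.pi ^ 2 : ℂ) • 1) ((4 * Real.pi ^ 2 : ℂ) • 1) (𝓕 g) := by
  have hspec : (secondDeriv N (besselEquiv N g) : 𝓢'(ℝ, Vec N)) =
      ∂_{(1 : ℝ)} (∂_{(1 : ℝ)} (besselInv N g : 𝓢'(ℝ, Vec N))) :=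
    (exists_secondDeriv (besselEquiv N g)).choose_spec
  have hgr : Function.HasTemperateGrowth (fun x : ℝ => (inner ℝ x (1 : ℝ) : ℝ)) := by fun_prop
  have hgr' : Function.HasTemperateGrowth (fun x : ℝ => ((inner ℝ x (1 : ℝ) : ℝ) : ℂ)) := by
    fun_prop
  apply toTemperedDistribution_inj
  rw [← Lp.fourier_toTemperedDistribution_eq, hspec, TemperedDistribution.fourier_lineDerivOp_eq,
    TemperedDistribution.fourier_lineDerivOp_eq, Lp.fourier_toTemperedDistribution_eq,
    fourier_besselInv, map_smul, smulLeftCLM_smulLeftCLM_apply hgr' hgr', smul_smul]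
  set q : ℝ → ℂ := fun x => (2 * Real.pi * Complex.I * (2 * Real.pi * Complex.I)) *
    (((inner ℝ x (1 : ℝ) : ℝ) : ℂ) * ((inner ℝ x (1 : ℝ) : ℝ) : ℂ)) with hq
  have hqg : Function.HasTemperateGrowth q := by fun_prop
  have h1 : (2 * Real.pi * Complex.I * (2 * Real.pi * Complex.I)) •
      smulLeftCLM (Vec N) ((fun x : ℝ => ((inner ℝ x (1 : ℝ) : ℝ) : ℂ)) *
        fun x : ℝ => ((inner ℝ x (1 : ℝ) : ℝ) : ℂ))
        ((affineMul 0 1 (𝓕 g) : L2 N) : 𝓢'(ℝ, Vec N)) =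
      smulLeftCLM (Vec N) q ((affineMul 0 1 (𝓕 g) : L2 N) : 𝓢'(ℝ, Vec N)) := by
    rw [← smul_apply, ← smulLeftCLM_smul (by fun_prop)]
    rfl
  refine h1.trans (smulLeftCLM_toTemperedDistribution hqg ?_)
  filter_upwards [coeFn_affineMul 0 1 (𝓕 g), coeFn_affineMul
    (-(4 * Real.pi ^ 2 : ℂ) • (1 : Vec N →L[ℂ] Vec N)) ((4 * Real.pi ^ 2 : ℂ) • 1) (𝓕 g)]
    with x hx1 hx2
  rw [hx2, hx1]
  have hne := ofReal_one_add_sq_ne_zero x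
  simp only [hq, zero_apply, zero_add, one_apply_eq_self, smul_apply,
    smul_smul, ← add_smul]
  congr 1
  simp only [besselSymbol]
  push_cast
  simp
  field_simp
  rw [Complex.I_sq]
  ring

end Sobolev

section Fredholm

/-- The range is unchanged and the kernels are isomorphic. The definition uses no topology on the
domain, so no norm on `H²` is needed. -/
theorem isFredholm_comp_equiv_iff {D D' E : Type*} [AddCommGroup D] [Module ℂ D] [AddCommGroup D']
    [Module ℂ D'] [NormedAddCommGroup E] [NormedSpace ℂ E] (T : D →ₗ[ℂ] E) (e : D' ≃ₗ[ℂ] D) :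
    IsFredholm (T ∘ₗ (e : D' →ₗ[ℂ] D)) ↔ IsFredholm T := by
  have hr : LinearMap.range (T ∘ₗ (e : D' →ₗ[ℂ] D)) = LinearMap.range T := e.range_comp T
  have hk : LinearMap.ker (T ∘ₗ (e : D' →ₗ[ℂ] D)) = (LinearMap.ker T).comap (e : D' →ₗ[ℂ] D) :=
    LinearMap.ker_comp _ _
  have ek : LinearMap.ker (T ∘ₗ (e : D' →ₗ[ℂ] D)) ≃ₗ[ℂ] LinearMap.ker T := by
    rw [hk]
    exact e.ofSubmodule' _
  constructor
  · rintro ⟨h1, h2, h3⟩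
    rw [hr] at h2 h3
    exact ⟨Module.Finite.equiv ek, h2, h3⟩
  · rintro ⟨h1, h2, h3⟩
    rw [← hr] at h2 h3
    exact ⟨Module.Finite.equiv ek.symm, h2, h3⟩

theorem isFredholm_of_continuousLinearMap {E : Type*} [NormedAddCommGroup E] [NormedSpace ℂ E]
    {T : E →L[ℂ] E} (hT : T.IsFredholm) : IsFredholm (T : E →ₗ[ℂ] E) :=
  ⟨hT.finite_ker, hT.isClosed_range, hT.finite_coker⟩

end Fredholm

/-! ### Reduction of the linearization to a multiplier plus a compact operator. -/

namespace Pulse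

open FourierTransform

variable {N : ℕ} [NeZero N] {ω k φ : ℝ}

/-- The deviation of the potential from its limit at infinity. -/
def localizedPotential (P : Pulse N ω k φ) (t : ℝ) : Vec N →L[ℂ] Vec N :=
  matAct (zeroOrderMatrix N ω k φ (P.toFun t)) - matAct (zeroOrderMatrix N ω k φ 0)

theorem tendsto_localizedPotential (P : Pulse N ω k φ) :
    Tendsto P.localizedPotential (cocompact ℝ) (𝓝 0) := by
  have h := ((continuous_zeroOrder N ω k φ).tendsto 0).comp (tendsto_pi_nhds.mpr P.decay)
  have h2 := h.sub_const (matAct (zeroOrderMatrix N ω k φ 0))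
  rw [sub_self] at h2
  exact h2

theorem memLp_localizedPotential (P : Pulse N ω k φ) :
    MemLp P.localizedPotential ∞ (volume : Measure ℝ) :=
  memLp_top_of_tendsto_cocompact (P.continuous_potential.sub continuous_const)
    P.tendsto_localizedPotential

/-- The relatively compact part of the linearization. -/
def compactPart (P : Pulse N ω k φ) : L2 N →L[ℂ] L2 N :=
  mulOp P.localizedPotential P.memLp_localizedPotential ∘L besselInv N

/-- The decay of the pulse makes the factor in `t` vanish at infinity, and the two derivatives
gained by the Bessel potential do the same for the factor in `x`. -/
theorem compactPart_mem (P : Pulse N ω k φ) : P.compactPart ∈ approxFiniteRank (L2 N) (L2 N) := by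
  have h := mem_approxFiniteRank_comp (mulOp_fourierInv_mulOp_mem P.memLp_localizedPotential
    (memLp_affineSymbol 0 1) P.tendsto_localizedPotential (tendsto_affineSymbol 0 1))
    (fourierL2 (Vec N))
  rw [ContinuousLinearMap.comp_assoc, ContinuousLinearMap.comp_assoc] at h
  exact h

end Pulse

variable {N : ℕ} [NeZero N]

theorem matAct_apply (M : Matrix (ZMod N ⊕ ZMod N) (ZMod N ⊕ ZMod N) ℝ) (v : Vec N)
    (i : ZMod N ⊕ ZMod N) : matAct M v i = ∑ j, (M i j : ℂ) * v j := by
  exact congrFun (Matrix.ofLp_toEuclideanCLM (M.map Complex.ofReal) v) i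

theorem matAct_symplecticMatrix_inl (v : Vec N) (n : ZMod N) :
    matAct (symplecticMatrix N) v (Sum.inl n) = v (Sum.inr n) := by
  simp [matAct_apply, symplecticMatrix, Fintype.sum_sum_type, Matrix.one_apply, apply_ite]

theorem matAct_symplecticMatrix_inr (v : Vec N) (n : ZMod N) :
    matAct (symplecticMatrix N) v (Sum.inr n) = -v (Sum.inl n) := by
  simp [matAct_apply, symplecticMatrix, Fintype.sum_sum_type, Matrix.one_apply, apply_ite]

/-- The limit at infinity of the Fourier symbol. -/
def symbolInfty (N : ℕ) [NeZero N] : Vec N →L[ℂ] Vec N :=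
  (-(4 * Real.pi ^ 2 : ℂ)) • matAct (symplecticMatrix N)

/-- The decaying part of the Fourier symbol. -/
def symbolDecay (N : ℕ) [NeZero N] (ω k φ : ℝ) (z : ℂ) : Vec N →L[ℂ] Vec N :=
  (4 * Real.pi ^ 2 : ℂ) • matAct (symplecticMatrix N) +
    (matAct (zeroOrderMatrix N ω k φ 0) - z • 1)

/-- The linearization about the zero state, minus `z`, composed with the inverse Bessel
potential. -/
def freePart (N : ℕ) [NeZero N] (ω k φ : ℝ) (z : ℂ) : L2 N →L[ℂ] L2 N :=
  fourierInvL2 (Vec N) ∘L affineMul (symbolInfty N) (symbolDecay N ω k φ z) ∘L fourierL2 (Vec N)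

open FourierTransform in
theorem linearization_comp_besselEquiv {ω k φ : ℝ} (P : Pulse N ω k φ) (z : ℂ) :
    (P.linearization.toFun - z • P.linearization.domain.subtype) ∘ₗ
      (besselEquiv N : L2 N →ₗ[ℂ] H2 N) =
      ((freePart N ω k φ z + P.compactPart : L2 N →L[ℂ] L2 N) : L2 N →ₗ[ℂ] L2 N) := by
  apply LinearMap.ext
  intro g
  set J := matAct (symplecticMatrix N) with hJ
  set M := matAct (zeroOrderMatrix N ω k φ 0) with hM
  have hpot : P.potentialOp (besselInv N g) =
      M.compLpL 2 volume (besselInv N g) + P.compactPart g := by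
    apply Lp.ext
    filter_upwards [(P.memLp_potential (besselInv N g)).coeFn_toLp,
      Lp.coeFn_add (M.compLpL 2 volume (besselInv N g)) (P.compactPart g),
      M.coeFn_compLpL (p := 2) (μ := volume) (besselInv N g),
      coeFn_mulOp P.localizedPotential P.memLp_localizedPotential (besselInv N g)] with t h1 h2 h3 h4
    have h5 : (P.potentialOp (besselInv N g) : L2 N) t =
      matAct (zeroOrderMatrix N ω k φ (P.toFun t)) (besselInv N g t) := h1
    have h6 : (P.compactPart g : L2 N) t = P.localizedPotential t (besselInv N g t) := h4
    rw [h5, h2, Pi.add_apply, h3, h6, Pulse.localizedPotential, sub_apply, ← hM]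
    abel
  have hfree : J.compLpL 2 volume (secondDeriv N (besselEquiv N g)) +
      M.compLpL 2 volume (besselInv N g) - z • besselInv N g = freePart N ω k φ z g := by
    have hinj : Function.Injective (𝓕 : L2 N → L2 N) :=
      (Lp.fourierTransformₗᵢ ℝ (Vec N)).injective
    apply hinj
    have h7 : 𝓕 (freePart N ω k φ z g) =
        affineMul (symbolInfty N) (symbolDecay N ω k φ z) (𝓕 g) :=
      (Lp.fourierTransformₗᵢ ℝ (Vec N)).apply_symm_apply _
    rw [h7, sub_eq_add_neg, ← neg_smul, FourierTransform.fourier_add, FourierTransform.fourier_add,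
      FourierTransform.fourier_smul, fourier_compLp, fourier_compLp,
      fourier_secondDeriv_besselEquiv, fourier_besselInv]
    set a := affineMul (-(4 * Real.pi ^ 2 : ℂ) • (1 : Vec N →L[ℂ] Vec N))
      ((4 * Real.pi ^ 2 : ℂ) • 1) (𝓕 g) with ha
    set b := affineMul 0 (1 : Vec N →L[ℂ] Vec N) (𝓕 g) with hb
    apply Lp.ext
    filter_upwards [coeFn_affineMul (symbolInfty N) (symbolDecay N ω k φ z) (𝓕 g),
      coeFn_affineMul (-(4 * Real.pi ^ 2 : ℂ) • (1 : Vec N →L[ℂ] Vec N))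
        ((4 * Real.pi ^ 2 : ℂ) • 1) (𝓕 g), coeFn_affineMul 0 (1 : Vec N →L[ℂ] Vec N) (𝓕 g),
      J.coeFn_compLpL (p := 2) (μ := volume) a, M.coeFn_compLpL (p := 2) (μ := volume) b,
      Lp.coeFn_add (J.compLpL 2 volume a + M.compLpL 2 volume b) (-z • b),
      Lp.coeFn_add (J.compLpL 2 volume a) (M.compLpL 2 volume b), Lp.coeFn_smul (-z) b]
      with x h1 h2 h3 h4 h5 h6 h7 h8
    rw [h6, Pi.add_apply, h7, Pi.add_apply, h8, Pi.smul_apply, h4, h5, h1, ha, hb, h2, h3]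
    simp only [symbolInfty, symbolDecay, ← hJ, ← hM, zero_apply, add_apply, sub_apply, smul_apply,
      one_apply_eq_self, map_add, map_smul, zero_add]
    module
  change J.compLpL 2 volume (secondDeriv N (besselEquiv N g)) + P.potentialOp (besselInv N g)
    - z • besselInv N g = freePart N ω k φ z g + P.compactPart g
  rw [hpot, ← hfree]
  abel

theorem mem_essentialSpectrum_iff {ω k φ : ℝ} (P : Pulse N ω k φ) (z : ℂ) :
    z ∈ essentialSpectrum P.linearization ↔
      ¬ IsFredholm ((freePart N ω k φ z + P.compactPart : L2 N →L[ℂ] L2 N) : L2 N →ₗ[ℂ] L2 N) := by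
  have h := isFredholm_comp_equiv_iff
    (P.linearization.toFun - z • P.linearization.domain.subtype) (besselEquiv N)
  rw [← linearization_comp_besselEquiv]
  exact not_congr h.symm

/-- The scalar factor never vanishes, so the symbol is singular at `x` exactly when `z` is an
eigenvalue of `M₀ - s J` with `s = 4π²x²`. -/
theorem affineSymbol_eq (ω k φ : ℝ) (z : ℂ) (x : ℝ) :
    affineSymbol N (symbolInfty N) (symbolDecay N ω k φ z) x =
      besselSymbol x • (matAct (zeroOrderMatrix N ω k φ 0) -
        ((4 * Real.pi ^ 2 * x ^ 2 : ℝ) : ℂ) • matAct (symplecticMatrix N) - z • 1) := by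
  have hne := ofReal_one_add_sq_ne_zero x
  ext1 v
  simp only [affineSymbol, symbolInfty, symbolDecay, add_apply, sub_apply, smul_apply,
    one_apply_eq_self]
  have h : (4 * Real.pi ^ 2 : ℂ) - (4 * Real.pi ^ 2 : ℂ) * besselSymbol x =
      besselSymbol x * ((4 * Real.pi ^ 2 * x ^ 2 : ℝ) : ℂ) := by
    simp only [besselSymbol]
    push_cast
    field_simp
    ring
  have h2 : besselSymbol x • (((4 * Real.pi ^ 2 * x ^ 2 : ℝ) : ℂ) • matAct (symplecticMatrix N) v) =
      ((4 * Real.pi ^ 2 : ℂ) - (4 * Real.pi ^ 2 : ℂ) * besselSymbol x) •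
        matAct (symplecticMatrix N) v := by
    rw [h, smul_smul]
  rw [smul_sub, smul_sub, h2]
  module

/-- If `M₀ - s J` has no eigenvalue `z` for `s ≥ 0`, then `z` is not in the essential spectrum. -/
theorem notMem_essentialSpectrum {ω k φ : ℝ} (P : Pulse N ω k φ) {z : ℂ}
    (h : ∀ s : ℝ, 0 ≤ s → ∀ v : Vec N, matAct (zeroOrderMatrix N ω k φ 0) v -
      (s : ℂ) • matAct (symplecticMatrix N) v = z • v → v = 0) :
    z ∉ essentialSpectrum P.linearization := by
  have hJ : IsUnit (matAct (symplecticMatrix N)) := by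
    rw [ContinuousLinearMap.isUnit_iff_bijective]
    have hi : Function.Injective (matAct (symplecticMatrix N) : Vec N →ₗ[ℂ] Vec N) := by
      rw [injective_iff_map_eq_zero]
      intro v hv
      have hv' : matAct (symplecticMatrix N) v = 0 := hv
      ext (n | n)
      · have := matAct_symplecticMatrix_inr v n
        rw [hv'] at this
        simpa using this.symm
      · have := matAct_symplecticMatrix_inl v n
        rw [hv'] at this
        simpa using this.symm
    exact ⟨hi, LinearMap.surjective_of_injective hi⟩
  have hinf : IsUnit (symbolInfty N) := by
    have h4 : (-(4 * Real.pi ^ 2 : ℂ)) ≠ 0 := by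
      simp [Real.pi_ne_zero]
    rw [symbolInfty]
    exact hJ.smul (Units.mk0 _ h4)
  have hunit : ∀ x, IsUnit (affineSymbol N (symbolInfty N) (symbolDecay N ω k φ z) x) := by
    intro x
    rw [ContinuousLinearMap.isUnit_iff_bijective]
    have hi : Function.Injective
        (affineSymbol N (symbolInfty N) (symbolDecay N ω k φ z) x : Vec N →ₗ[ℂ] Vec N) := by
      rw [injective_iff_map_eq_zero]
      intro v hv
      have hv' : affineSymbol N (symbolInfty N) (symbolDecay N ω k φ z) x v = 0 := hv
      rw [affineSymbol_eq, smul_apply, smul_eq_zero] at hv'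
      have hb : besselSymbol x ≠ 0 :=
        Complex.ofReal_ne_zero.2 (by positivity)
      have h1 := hv'.resolve_left hb
      refine h (4 * Real.pi ^ 2 * x ^ 2) (by positivity) v ?_
      simp only [sub_apply, smul_apply, one_apply_eq_self] at h1
      exact sub_eq_zero.1 h1
    exact ⟨hi, LinearMap.surjective_of_injective hi⟩
  have hfree : IsUnit (freePart N ω k φ z) := by
    have h1 : IsUnit (affineMul (symbolInfty N) (symbolDecay N ω k φ z)) :=
      isUnit_mulOp (continuous_affineSymbol _ _) _ (tendsto_affineSymbol _ _) hinf hunit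
    rw [ContinuousLinearMap.isUnit_iff_bijective] at h1 ⊢
    exact (Lp.fourierTransformₗᵢ ℝ (Vec N)).symm.bijective.comp
      (h1.comp (Lp.fourierTransformₗᵢ ℝ (Vec N)).bijective)
  rw [mem_essentialSpectrum_iff, not_not]
  exact isFredholm_of_continuousLinearMap (isFredholm_isUnit_add hfree P.compactPart_mem)

/-- If `M₀ - s J` has the eigenvalue `z` for some `s ≥ 0`, then `z` is in the essential
spectrum. -/
theorem mem_essentialSpectrum {ω k φ : ℝ} (P : Pulse N ω k φ) {z : ℂ} {s : ℝ} (hs : 0 ≤ s)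
    {v : Vec N} (hv0 : v ≠ 0) (hv : matAct (zeroOrderMatrix N ω k φ 0) v -
      (s : ℂ) • matAct (symplecticMatrix N) v = z • v) :
    z ∈ essentialSpectrum P.linearization := by
  rw [mem_essentialSpectrum_iff]
  intro hF
  set x₀ : ℝ := Real.sqrt s / (2 * Real.pi) with hx₀
  have hx : 4 * Real.pi ^ 2 * x₀ ^ 2 = s := by
    rw [hx₀, div_pow, Real.sq_sqrt hs]
    field_simp
    ring
  set w : Vec N := ((‖v‖⁻¹ : ℝ) : ℂ) • v with hw
  have hnv : ‖v‖ ≠ 0 := norm_ne_zero_iff.2 hv0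
  have hw1 : ‖w‖ = 1 := by
    rw [hw, norm_smul, Complex.norm_real, norm_inv, norm_norm, inv_mul_cancel₀ hnv]
  have h0 : affineSymbol N (symbolInfty N) (symbolDecay N ω k φ z) x₀ w = 0 := by
    rw [affineSymbol_eq, hx, hw, map_smul]
    simp only [sub_apply, smul_apply, one_apply_eq_self]
    rw [hv, sub_self, smul_zero, smul_zero]
  obtain ⟨e, he, het⟩ := exists_orthonormal_tendsto_mulOp
    (continuous_affineSymbol (symbolInfty N) (symbolDecay N ω k φ z))
    (memLp_affineSymbol _ _) hw1 h0
  let U := Lp.fourierTransformₗᵢ ℝ (Vec N)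
  have he' : Orthonormal ℂ (fun n => U.symm (e n)) := he.comp_linearIsometryEquiv U.symm
  have h1 : Tendsto (fun n => freePart N ω k φ z (U.symm (e n))) atTop (𝓝 0) := by
    have h2 := ((fourierInvL2 (Vec N)).continuous.tendsto 0).comp het
    rw [map_zero] at h2
    refine h2.congr fun n => ?_
    change fourierInvL2 (Vec N) (affineMul _ _ (e n)) =
      fourierInvL2 (Vec N) (affineMul _ _ (U (U.symm (e n))))
    rw [U.apply_symm_apply]
  have h3 := h1.add (tendsto_approxFiniteRank_orthonormal P.compactPart_mem he')
  rw [add_zero] at h3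
  exact not_tendsto_of_isFredholm (T := freePart N ω k φ z + P.compactPart)
    hF.finite_ker hF.isClosed_range he' h3

/-! ### The eigenvalues of the symbol -/

section Coupling

variable {N : ℕ} [NeZero N]

theorem couplingMatrix_mulVec (φ : ℝ) (p : ZMod N → ℂ) (n : ZMod N) :
    (couplingMatrix N φ).mulVec p n =
      Complex.exp (Complex.I * φ) * p (n - 1) + Complex.exp (-(Complex.I * φ)) * p (n + 1) := by
  simp [couplingMatrix, Matrix.mulVec, dotProduct, add_mul, Finset.sum_add_distrib]

theorem conj_couplingMatrix (φ : ℝ) (n m : ZMod N) :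
    (starRingEnd ℂ) (couplingMatrix N φ n m) = couplingMatrix N (-φ) n m := by
  simp only [couplingMatrix, Matrix.of_apply, map_add]
  congr 1 <;> split_ifs <;> simp [← Complex.exp_conj]

/-- The eigenvalue of the coupling matrix on the character with index `-j`. -/
theorem exp_mul_stdAddChar_add (φ : ℝ) (j : ℤ) :
    Complex.exp (Complex.I * φ) * ZMod.stdAddChar (j : ZMod N) +
      Complex.exp (-(Complex.I * φ)) * ZMod.stdAddChar (-(j : ZMod N)) =
      ((2 * Real.cos (φ + 2 * Real.pi * j / N) : ℝ) : ℂ) := by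
  rw [← Int.cast_neg, ZMod.stdAddChar_coe, ZMod.stdAddChar_coe, ← Complex.exp_add,
    ← Complex.exp_add]
  push_cast
  rw [Complex.cos]
  rw [show Complex.I * (φ : ℂ) + 2 * Real.pi * Complex.I * j / N =
    ((φ : ℂ) + 2 * Real.pi * j / N) * Complex.I by ring,
    show -(Complex.I * (φ : ℂ)) + 2 * Real.pi * Complex.I * (-j) / N =
    -((φ : ℂ) + 2 * Real.pi * j / N) * Complex.I by ring]
  ring

theorem couplingMatrix_mulVec_stdAddChar (φ : ℝ) (j : ℤ) (n : ZMod N) :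
    (couplingMatrix N φ).mulVec (fun n => ZMod.stdAddChar (-(n * (j : ZMod N)))) n =
      ((2 * Real.cos (φ + 2 * Real.pi * j / N) : ℝ) : ℂ) * ZMod.stdAddChar (-(n * (j : ZMod N))) := by
  rw [couplingMatrix_mulVec, ← exp_mul_stdAddChar_add,
    show -((n - 1) * (j : ZMod N)) = (j : ZMod N) + -(n * (j : ZMod N)) by ring,
    show -((n + 1) * (j : ZMod N)) = -(j : ZMod N) + -(n * (j : ZMod N)) by ring,
    AddChar.map_add_eq_mul, AddChar.map_add_eq_mul]
  ring

/-- The discrete Fourier transform turns the shifts `n ↦ n ± 1` into multiplication by character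
values. An eigenvector has some nonzero Fourier coefficient, which then pins down the eigenvalue. -/
theorem dft_couplingMatrix_mulVec (φ : ℝ) (p : ZMod N → ℂ) (j : ℤ) :
    ZMod.dft ((couplingMatrix N φ).mulVec p) (-(j : ZMod N)) =
      ((2 * Real.cos (φ + 2 * Real.pi * j / N) : ℝ) : ℂ) * ZMod.dft p (-(j : ZMod N)) := by
  have h1 : ∑ n : ZMod N, ZMod.stdAddChar (-(n * -(j : ZMod N))) * p (n - 1) =
      ZMod.stdAddChar (j : ZMod N) * ∑ n : ZMod N, ZMod.stdAddChar (-(n * -(j : ZMod N))) * p n := by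
    rw [Finset.mul_sum]
    refine Fintype.sum_equiv (Equiv.subRight 1) _ _ fun n => ?_
    rw [Equiv.subRight_apply, ← mul_assoc, ← AddChar.map_add_eq_mul]
    congr 2
    ring
  have h2 : ∑ n : ZMod N, ZMod.stdAddChar (-(n * -(j : ZMod N))) * p (n + 1) =
      ZMod.stdAddChar (-(j : ZMod N)) *
        ∑ n : ZMod N, ZMod.stdAddChar (-(n * -(j : ZMod N))) * p n := by
    rw [Finset.mul_sum]
    refine Fintype.sum_equiv (Equiv.addRight 1) _ _ fun n => ?_
    rw [Equiv.coe_addRight, ← mul_assoc, ← AddChar.map_add_eq_mul]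
    congr 2
    ring
  rw [← exp_mul_stdAddChar_add, ZMod.dft_apply, ZMod.dft_apply]
  simp only [smul_eq_mul, couplingMatrix_mulVec, mul_add, Finset.sum_add_distrib,
    mul_left_comm _ (Complex.exp _)]
  rw [← Finset.mul_sum, ← Finset.mul_sum, h1, h2]
  ring

/-- An eigenvalue of the coupling matrix is one of the numbers `2 cos (φ + 2πj/N)`. -/
theorem exists_eq_of_couplingMatrix_mulVec {φ : ℝ} {p : ZMod N → ℂ} (hp : p ≠ 0) {a b : ℂ}
    (h : ∀ n, a * p n = b * (couplingMatrix N φ).mulVec p n) :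
    ∃ j : ℤ, a = b * ((2 * Real.cos (φ + 2 * Real.pi * j / N) : ℝ) : ℂ) := by
  have hp' : ZMod.dft p ≠ 0 := fun h0 => hp ((LinearEquiv.map_eq_zero_iff _).1 h0)
  obtain ⟨m, hm⟩ := Function.ne_iff.1 hp'
  have hj : -(((-(m.val : ℤ)) : ℤ) : ZMod N) = m := by simp
  refine ⟨-(m.val : ℤ), ?_⟩
  have h1 : a • p = b • (couplingMatrix N φ).mulVec p := funext h
  have h2 := congrFun (congrArg ZMod.dft h1) (-(((-(m.val : ℤ)) : ℤ) : ZMod N))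
  rw [map_smul, map_smul, Pi.smul_apply, Pi.smul_apply, dft_couplingMatrix_mulVec, hj, smul_eq_mul,
    smul_eq_mul, ← mul_assoc] at h2
  exact mul_right_cancel₀ hm h2

theorem couplingRe_add_couplingIm (φ : ℝ) (n m : ZMod N) :
    (couplingRe N φ n m : ℂ) + Complex.I * couplingIm N φ n m = couplingMatrix N φ n m := by
  rw [mul_comm]; exact Complex.re_add_im _

theorem couplingRe_sub_couplingIm (φ : ℝ) (n m : ZMod N) :
    (couplingRe N φ n m : ℂ) - Complex.I * couplingIm N φ n m = couplingMatrix N (-φ) n m := by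
  rw [← conj_couplingMatrix, ← couplingRe_add_couplingIm, map_add, map_mul, Complex.conj_I,
    Complex.conj_ofReal, Complex.conj_ofReal]
  ring

/-- The symbol of the linearization about the zero state. -/
def freeSymbol (N : ℕ) [NeZero N] (ω k φ s : ℝ) (v : Vec N) : Vec N :=
  matAct (zeroOrderMatrix N ω k φ 0) v - (s : ℂ) • matAct (symplecticMatrix N) v

theorem freeSymbol_inl (ω k φ s : ℝ) (v : Vec N) (n : ZMod N) :
    freeSymbol N ω k φ s v (Sum.inl n) = k * ∑ m, couplingIm N φ n m * v (Sum.inl m) +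
      k * ∑ m, couplingRe N φ n m * v (Sum.inr m) - (ω + s) * v (Sum.inr n) := by
  rw [freeSymbol, PiLp.sub_apply, PiLp.smul_apply, matAct_symplecticMatrix_inl, matAct_apply,
    Fintype.sum_sum_type]
  simp [zeroOrderMatrix, Matrix.one_apply, add_mul, Finset.sum_add_distrib, Finset.mul_sum,
    mul_assoc, apply_ite]
  ring

theorem freeSymbol_inr (ω k φ s : ℝ) (v : Vec N) (n : ZMod N) :
    freeSymbol N ω k φ s v (Sum.inr n) = k * ∑ m, couplingIm N φ n m * v (Sum.inr m) -
      k * ∑ m, couplingRe N φ n m * v (Sum.inl m) + (ω + s) * v (Sum.inl n) := by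
  rw [freeSymbol, PiLp.sub_apply, PiLp.smul_apply, matAct_symplecticMatrix_inr, matAct_apply,
    Fintype.sum_sum_type]
  simp [zeroOrderMatrix, Matrix.one_apply, sub_mul, Finset.sum_sub_distrib, Finset.mul_sum,
    mul_assoc, apply_ite]
  ring

/-- The component `u + i v`. -/
def holPart (v : Vec N) (n : ZMod N) : ℂ := v (Sum.inl n) + Complex.I * v (Sum.inr n)

/-- The component `u - i v`. -/
def antiholPart (v : Vec N) (n : ZMod N) : ℂ := v (Sum.inl n) - Complex.I * v (Sum.inr n)

/-- After complexification the components `u` and `v` are themselves complex, so `u + iv` and `u -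
iv` are independent coordinates, not conjugates. -/
theorem ext_holPart {v w : Vec N} (h1 : holPart v = holPart w)
    (h2 : antiholPart v = antiholPart w) : v = w := by
  have hI := Complex.I_ne_zero
  ext (n | n)
  · have e1 := congrFun h1 n
    have e2 := congrFun h2 n
    simp only [holPart, antiholPart] at e1 e2
    linear_combination (1 / 2) * e1 + (1 / 2) * e2
  · have e1 := congrFun h1 n
    have e2 := congrFun h2 n
    simp only [holPart, antiholPart] at e1 e2
    refine mul_left_cancel₀ hI ?_
    linear_combination (1 / 2) * e1 - (1 / 2) * e2

theorem holPart_smul (z : ℂ) (v : Vec N) (n : ZMod N) : holPart (z • v) n = z * holPart v n := by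
  simp only [holPart, PiLp.smul_apply, smul_eq_mul]; ring

theorem antiholPart_smul (z : ℂ) (v : Vec N) (n : ZMod N) :
    antiholPart (z • v) n = z * antiholPart v n := by
  simp only [antiholPart, PiLp.smul_apply, smul_eq_mul]; ring

/-- The symbol is built from `J` and `A_c`, `A_s` acting alike on both blocks. On `u + iv` the
matrix `J` acts as `-i`, which recombines `A_c + i A_s` into `A(φ)`; on `u - iv` it acts as `i` and
gives the conjugate `A(-φ)`. -/
theorem holPart_freeSymbol (ω k φ s : ℝ) (v : Vec N) (n : ZMod N) :
    holPart (freeSymbol N ω k φ s v) n = Complex.I * (ω + s) * holPart v n -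
      Complex.I * k * (couplingMatrix N φ).mulVec (holPart v) n := by
  have h : (couplingMatrix N φ).mulVec (holPart v) n =
      (∑ m, couplingRe N φ n m * v (Sum.inl m)) - (∑ m, couplingIm N φ n m * v (Sum.inr m)) +
      Complex.I * ((∑ m, couplingIm N φ n m * v (Sum.inl m)) +
        ∑ m, couplingRe N φ n m * v (Sum.inr m)) := by
    rw [← Finset.sum_sub_distrib, ← Finset.sum_add_distrib, Finset.mul_sum,
      ← Finset.sum_add_distrib]
    refine Finset.sum_congr rfl fun m _ => ?_
    change couplingMatrix N φ n m * holPart v m = _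
    rw [← couplingRe_add_couplingIm, holPart]
    linear_combination (couplingIm N φ n m : ℂ) * v (Sum.inr m) * Complex.I_sq
  rw [h, holPart, holPart, freeSymbol_inl, freeSymbol_inr]
  linear_combination ((ω + s) * v (Sum.inr n) - k * (∑ m, couplingIm N φ n m * v (Sum.inl m)) -
    k * ∑ m, couplingRe N φ n m * v (Sum.inr m)) * (-Complex.I_sq)

theorem antiholPart_freeSymbol (ω k φ s : ℝ) (v : Vec N) (n : ZMod N) :
    antiholPart (freeSymbol N ω k φ s v) n = -(Complex.I * (ω + s)) * antiholPart v n +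
      Complex.I * k * (couplingMatrix N (-φ)).mulVec (antiholPart v) n := by
  have h : (couplingMatrix N (-φ)).mulVec (antiholPart v) n =
      (∑ m, couplingRe N φ n m * v (Sum.inl m)) - (∑ m, couplingIm N φ n m * v (Sum.inr m)) -
      Complex.I * ((∑ m, couplingIm N φ n m * v (Sum.inl m)) +
        ∑ m, couplingRe N φ n m * v (Sum.inr m)) := by
    rw [← Finset.sum_sub_distrib, ← Finset.sum_add_distrib, Finset.mul_sum,
      ← Finset.sum_sub_distrib]
    refine Finset.sum_congr rfl fun m _ => ?_
    change couplingMatrix N (-φ) n m * antiholPart v m = _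
    rw [← couplingRe_sub_couplingIm, antiholPart]
    linear_combination (couplingIm N φ n m : ℂ) * v (Sum.inr m) * Complex.I_sq
  rw [h, antiholPart, antiholPart, freeSymbol_inl, freeSymbol_inr]
  linear_combination ((ω + s) * v (Sum.inr n) - k * (∑ m, couplingIm N φ n m * v (Sum.inl m)) -
    k * ∑ m, couplingRe N φ n m * v (Sum.inr m)) * (-Complex.I_sq)

/-- Every eigenvalue of the symbol is `± i (s + ω - 2k cos (φ + 2πj/N))`. -/
theorem exists_eq_of_freeSymbol_eq {ω k φ s : ℝ} {z : ℂ} {v : Vec N} (hv0 : v ≠ 0)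
    (hv : freeSymbol N ω k φ s v = z • v) :
    ∃ j : ℤ, z = Complex.I * ((s + (ω - 2 * k * Real.cos (φ + 2 * Real.pi * j / N)) : ℝ) : ℂ) ∨
      z = Complex.I * ((-(s + (ω - 2 * k * Real.cos (φ + 2 * Real.pi * j / N))) : ℝ) : ℂ) := by
  by_cases hp : holPart v = 0
  · have hq : antiholPart v ≠ 0 := fun hq => hv0 (ext_holPart
      (by rw [hp]; ext n; simp [holPart]) (by rw [hq]; ext n; simp [antiholPart]))
    obtain ⟨j, hj⟩ := exists_eq_of_couplingMatrix_mulVec hq (φ := -φ)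
      (a := z + Complex.I * (ω + s)) (b := Complex.I * k) fun n => by
        have h := antiholPart_freeSymbol ω k φ s v n
        rw [hv, antiholPart_smul] at h
        linear_combination h
    refine ⟨-j, Or.inr ?_⟩
    have hc : Real.cos (φ + 2 * Real.pi * ((-j : ℤ) : ℝ) / N) =
        Real.cos (-φ + 2 * Real.pi * j / N) := by
      rw [← Real.cos_neg]
      congr 1
      push_cast
      ring
    rw [hc]
    push_cast at hj ⊢
    linear_combination hj
  · obtain ⟨j, hj⟩ := exists_eq_of_couplingMatrix_mulVec hp (φ := φ)
      (a := Complex.I * (ω + s) - z) (b := Complex.I * k) fun n => by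
        have h := holPart_freeSymbol ω k φ s v n
        rw [hv, holPart_smul] at h
        linear_combination -h
    refine ⟨j, Or.inl ?_⟩
    push_cast at hj ⊢
    linear_combination -hj

theorem exists_freeSymbol_eq_pos (ω k φ s : ℝ) (j : ℤ) : ∃ v : Vec N, v ≠ 0 ∧
    freeSymbol N ω k φ s v =
      (Complex.I * ((s + (ω - 2 * k * Real.cos (φ + 2 * Real.pi * j / N)) : ℝ) : ℂ)) • v := by
  let e : ZMod N → ℂ := fun n => ZMod.stdAddChar (-(n * (j : ZMod N)))
  -- The second block is `-i` times the first, so that `u - iv` vanishes and only the `A(φ)` block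
  -- acts.
  let v : Vec N := WithLp.toLp 2 (Sum.elim e fun n => -Complex.I * e n)
  have hp : holPart v = (2 : ℂ) • e := by
    ext n
    simp only [holPart, v, Sum.elim_inl, Sum.elim_inr, Pi.smul_apply, smul_eq_mul]
    linear_combination -(e n) * Complex.I_sq
  have hq : antiholPart v = 0 := by
    ext n
    simp only [antiholPart, v, Sum.elim_inl, Sum.elim_inr, Pi.zero_apply]
    linear_combination (e n) * Complex.I_sq
  refine ⟨v, fun h => ?_, ext_holPart ?_ ?_⟩
  · have : v (Sum.inl 0) = 1 := by simp [v, e]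
    rw [h] at this
    simp at this
  · ext n
    rw [holPart_freeSymbol, holPart_smul, hp, Matrix.mulVec_smul, Pi.smul_apply, Pi.smul_apply,
      couplingMatrix_mulVec_stdAddChar, smul_eq_mul, smul_eq_mul]
    push_cast
    ring
  · ext n
    rw [antiholPart_freeSymbol, antiholPart_smul, hq, Matrix.mulVec_zero]
    simp

theorem exists_freeSymbol_eq_neg (ω k φ s : ℝ) (j : ℤ) : ∃ v : Vec N, v ≠ 0 ∧
    freeSymbol N ω k φ s v =
      (Complex.I * ((-(s + (ω - 2 * k * Real.cos (φ + 2 * Real.pi * j / N))) : ℝ) : ℂ)) • v := by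
  -- The index is `-j` because `u - iv` is governed by `A(-φ)`, and the cosine is even.
  let e : ZMod N → ℂ := fun n => ZMod.stdAddChar (-(n * ((-j : ℤ) : ZMod N)))
  let v : Vec N := WithLp.toLp 2 (Sum.elim e fun n => Complex.I * e n)
  have hp : holPart v = 0 := by
    ext n
    simp only [holPart, v, Sum.elim_inl, Sum.elim_inr, Pi.zero_apply]
    linear_combination (e n) * Complex.I_sq
  have hq : antiholPart v = (2 : ℂ) • e := by
    ext n
    simp only [antiholPart, v, Sum.elim_inl, Sum.elim_inr, Pi.smul_apply, smul_eq_mul]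
    linear_combination -(e n) * Complex.I_sq
  have hc : Real.cos (-φ + 2 * Real.pi * ((-j : ℤ) : ℝ) / N) =
      Real.cos (φ + 2 * Real.pi * j / N) := by
    rw [← Real.cos_neg]
    congr 1
    push_cast
    ring
  refine ⟨v, fun h => ?_, ext_holPart ?_ ?_⟩
  · have : v (Sum.inl 0) = 1 := by simp [v, e]
    rw [h] at this
    simp at this
  · ext n
    rw [holPart_freeSymbol, holPart_smul, hp, Matrix.mulVec_zero]
    simp
  · ext n
    rw [antiholPart_freeSymbol, antiholPart_smul, hq, Matrix.mulVec_smul, Pi.smul_apply,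
      Pi.smul_apply, couplingMatrix_mulVec_stdAddChar, smul_eq_mul, smul_eq_mul, hc]
    rw [show ZMod.stdAddChar (-(n * ((-j : ℤ) : ZMod N))) = e n from rfl]
    generalize e n = y
    push_cast
    ring

end Coupling

/-! ### The edge function -/

section Edge

/-- On the fundamental interval, `α` is given by the distance to `(2π/N)ℤ`. -/
theorem edgeBase_eq (N : ℕ) (ω k x : ℝ) :
    edgeBase N ω k x = ω - 2 * k * Real.cos (min x (2 * Real.pi / N - x)) := by
  have h : 2 * Real.pi / N = Real.pi / N + Real.pi / N := by ring
  unfold edgeBase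
  split_ifs with hx
  · rw [min_eq_left (by linarith)]
  · rw [min_eq_right (by linarith)]

variable (N : ℕ) [NeZero N]

theorem exists_edge_eq (ω k φ : ℝ) : ∃ x : ℝ, ∃ i : ℤ, 0 ≤ x ∧ x < 2 * Real.pi / N ∧
    φ = x + 2 * Real.pi * i / N ∧
    edge N ω k φ = ω - 2 * k * Real.cos (min x (2 * Real.pi / N - x)) := by
  refine ⟨toIcoMod (period_pos N) 0 φ, toIcoDiv (period_pos N) 0 φ, ?_, ?_, ?_, edgeBase_eq N _ _ _⟩
  · exact left_le_toIcoMod _ _ _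
  · simpa using toIcoMod_lt_right (period_pos N) 0 φ
  · have h := toIcoMod_add_toIcoDiv_zsmul (period_pos N) 0 φ
    rw [zsmul_eq_mul] at h
    linear_combination -h

/-- The point of `φ + (2π/N)ℤ` nearest to `0` is `x` or `x - 2π/N`, where `x` is the residue of `φ`
in `[0, 2π/N)`. -/
theorem exists_edge_eq_cos (ω k φ : ℝ) :
    ∃ j : ℤ, edge N ω k φ = ω - 2 * k * Real.cos (φ + 2 * Real.pi * j / N) := by
  obtain ⟨x, i, -, -, hφ, he⟩ := exists_edge_eq N ω k φ
  rcases le_total x (2 * Real.pi / N - x) with h | h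
  · refine ⟨-i, ?_⟩
    rw [he, min_eq_left h, hφ]
    congr 3
    push_cast
    ring
  · refine ⟨-i - 1, ?_⟩
    rw [he, min_eq_right h, hφ, ← Real.cos_neg (2 * Real.pi / N - x)]
    congr 3
    push_cast
    ring

/-- Reduced to `y ∈ (-π, π]`, the angle is still at least as far from `0` as the nearest point of `φ
+ (2π/N)ℤ`, and cosine decreases on `[0, π]`. -/
theorem edge_le {ω k : ℝ} (hk : 0 ≤ k) (φ : ℝ) (j : ℤ) :
    edge N ω k φ ≤ ω - 2 * k * Real.cos (φ + 2 * Real.pi * j / N) := by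
  obtain ⟨x, i, hx0, hx1, hφ, he⟩ := exists_edge_eq N ω k φ
  have hN : (0 : ℝ) < N := Nat.cast_pos.mpr (NeZero.pos N)
  have hper := period_pos N
  set y : ℝ := toIocMod Real.two_pi_pos (-Real.pi) (φ + 2 * Real.pi * j / N) with hy
  have hy1 : -Real.pi < y := left_lt_toIocMod _ _ _
  have hy2 : y ≤ Real.pi := by
    have := toIocMod_le_right Real.two_pi_pos (-Real.pi) (φ + 2 * Real.pi * j / N)
    linarith
  set d : ℤ := toIocDiv Real.two_pi_pos (-Real.pi) (φ + 2 * Real.pi * j / N) with hd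
  have hyd : y + d * (2 * Real.pi) = φ + 2 * Real.pi * j / N := by
    have h := toIocMod_add_toIocDiv_zsmul Real.two_pi_pos (-Real.pi) (φ + 2 * Real.pi * j / N)
    rwa [zsmul_eq_mul] at h
  have hcos : Real.cos (φ + 2 * Real.pi * j / N) = Real.cos |y| := by
    rw [← hyd, Real.cos_add_int_mul_two_pi, Real.cos_abs]
  -- A full turn `2π` is `N` steps of `2π/N`, so `y` stays in the coset. For `m ≥ 0` it is at least
  -- `x`; for `m ≤ -1` it is at most `x - 2π/N`.
  set m : ℤ := i + j - d * N with hm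
  have hym : y = x + m * (2 * Real.pi / N) := by
    rw [hm]
    push_cast
    have : y = φ + 2 * Real.pi * j / N - d * (2 * Real.pi) := by linarith
    rw [this, hφ]
    field_simp
    ring
  have hmin : min x (2 * Real.pi / N - x) ≤ |y| := by
    rcases le_or_gt 0 m with h | h
    · have h1 : (0 : ℝ) ≤ m := by exact_mod_cast h
      refine (min_le_left _ _).trans (le_trans ?_ (le_abs_self y))
      rw [hym]
      nlinarith
    · have h1 : (m : ℝ) ≤ -1 := by exact_mod_cast Int.le_sub_one_of_lt h
      refine (min_le_right _ _).trans (le_trans ?_ (neg_le_abs y))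
      rw [hym]
      nlinarith
  have h0 : 0 ≤ min x (2 * Real.pi / N - x) := le_min hx0 (by linarith)
  have hle : Real.cos |y| ≤ Real.cos (min x (2 * Real.pi / N - x)) :=
    Real.cos_le_cos_of_nonneg_of_le_pi h0 (abs_le.2 ⟨hy1.le, hy2⟩) hmin
  rw [he, hcos]
  have := mul_le_mul_of_nonneg_left hle (by linarith : 0 ≤ 2 * k)
  linarith

theorem edge_pi_div (ω k : ℝ) :
    edge N ω k (Real.pi / N) = ω - 2 * k * Real.cos (Real.pi / N) := by
  have hN : (0 : ℝ) < N := Nat.cast_pos.mpr (NeZero.pos N)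
  have hpos : 0 < Real.pi / N := div_pos Real.pi_pos hN
  have h : 2 * Real.pi / N = Real.pi / N + Real.pi / N := by ring
  have hmod : toIcoMod (period_pos N) 0 (Real.pi / N) = Real.pi / N := by
    rw [toIcoMod_eq_self]
    exact ⟨hpos.le, by linarith⟩
  rw [edge, hmod, edgeBase, if_pos le_rfl]

theorem edge_le_edge_pi_div {ω k : ℝ} (hk : 0 ≤ k) (φ : ℝ) :
    edge N ω k φ ≤ edge N ω k (Real.pi / N) := by
  obtain ⟨x, i, hx0, hx1, -, he⟩ := exists_edge_eq N ω k φ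
  have hN : (1 : ℝ) ≤ N := Nat.one_le_cast.2 (NeZero.pos N)
  have h : 2 * Real.pi / N = Real.pi / N + Real.pi / N := by ring
  have hle : min x (2 * Real.pi / N - x) ≤ Real.pi / N := by
    rcases le_total x (Real.pi / N) with h1 | h1
    · exact (min_le_left _ _).trans h1
    · exact (min_le_right _ _).trans (by linarith)
  have hcos : Real.cos (Real.pi / N) ≤ Real.cos (min x (2 * Real.pi / N - x)) :=
    Real.cos_le_cos_of_nonneg_of_le_pi (le_min hx0 (by linarith))
      (div_le_self Real.pi_pos.le hN) hle
  rw [he, edge_pi_div]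
  have := mul_le_mul_of_nonneg_left hcos (by linarith : 0 ≤ 2 * k)
  linarith

end Edge

/-! ### Assembling the bands. -/

section Bands

theorem mem_upperBand {a : ℝ} {z : ℂ} :
    z ∈ upperBand a ↔ ∃ t : ℝ, a ≤ t ∧ Complex.I * (t : ℂ) = z := Iff.rfl

theorem mem_lowerBand {a : ℝ} {z : ℂ} :
    z ∈ lowerBand a ↔ ∃ t : ℝ, t ≤ -a ∧ Complex.I * (t : ℂ) = z := Iff.rfl

theorem essentialSpectrum_linearization {N : ℕ} [NeZero N] {ω k φ : ℝ} (hk : 0 ≤ k) (P : Pulse N ω k φ) :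
    essentialSpectrum P.linearization =
      lowerBand (edge N ω k φ) ∪ upperBand (edge N ω k φ) := by
  ext z
  constructor
  · intro hz
    by_contra hcon
    refine notMem_essentialSpectrum P (fun s hs v hv => ?_) hz
    by_contra hv0
    obtain ⟨j, hj | hj⟩ := exists_eq_of_freeSymbol_eq hv0 hv
    · have h := edge_le N (ω := ω) hk φ j
      exact hcon (Or.inr (mem_upperBand.2 ⟨_, by linarith, hj.symm⟩))
    · have h := edge_le N (ω := ω) hk φ j
      exact hcon (Or.inl (mem_lowerBand.2 ⟨_, by linarith, hj.symm⟩))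
  · obtain ⟨j, hj⟩ := exists_edge_eq_cos N ω k φ
    rintro (⟨t, ht, rfl⟩ | ⟨t, ht, rfl⟩)
    · have ht' : t ≤ -edge N ω k φ := ht
      -- For the index `j` attaining `α`, the value `s = -t - α ≥ 0` puts the eigenvalue `-i(s + α)`
      -- exactly at `it`.
      obtain ⟨v, hv0, hv⟩ := exists_freeSymbol_eq_neg (N := N) ω k φ (-t - edge N ω k φ) j
      rw [← hj, show -(-t - edge N ω k φ + edge N ω k φ) = t by ring] at hv
      exact mem_essentialSpectrum P (by linarith) hv0 hv
    · have ht' : edge N ω k φ ≤ t := ht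
      obtain ⟨v, hv0, hv⟩ := exists_freeSymbol_eq_pos (N := N) ω k φ (t - edge N ω k φ) j
      rw [← hj, sub_add_cancel] at hv
      exact mem_essentialSpectrum P (by linarith) hv0 hv

theorem mem_lowerBand_iff_neg_mem_upperBand (a : ℝ) (z : ℂ) :
    z ∈ lowerBand a ↔ -z ∈ upperBand a := by
  rw [mem_lowerBand, mem_upperBand]
  constructor
  · rintro ⟨t, ht, rfl⟩
    exact ⟨-t, by linarith, by push_cast; ring⟩
  · rintro ⟨t, ht, h⟩
    exact ⟨-t, by linarith, by push_cast; rw [← neg_neg z, ← h]; ring⟩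

theorem disjoint_bands {a : ℝ} (ha : 0 < a) : Disjoint (lowerBand a) (upperBand a) := by
  rw [Set.disjoint_left]
  rintro z ⟨t, ht, rfl⟩ ⟨t', ht', h⟩
  have h1 : t' = t := Complex.ofReal_injective (mul_left_cancel₀ Complex.I_ne_zero h)
  have h2 : t ≤ -a := ht
  have h3 : a ≤ t' := ht'
  linarith

end Bands

end TwistedFiber
end

theorem proposition1 (N : ℕ) [NeZero N] (ω k : ℝ) (hk : 0 ≤ k) :
    (∀ (φ : ℝ) (P : TwistedFiber.Pulse N ω k φ), 0 < TwistedFiber.edge N ω k φ →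
      TwistedFiber.essentialSpectrum P.linearization
          = TwistedFiber.lowerBand (TwistedFiber.edge N ω k φ) ∪
            TwistedFiber.upperBand (TwistedFiber.edge N ω k φ) ∧
        (∀ z : ℂ, z ∈ TwistedFiber.lowerBand (TwistedFiber.edge N ω k φ) ↔
          -z ∈ TwistedFiber.upperBand (TwistedFiber.edge N ω k φ)) ∧
        Disjoint (TwistedFiber.lowerBand (TwistedFiber.edge N ω k φ))
          (TwistedFiber.upperBand (TwistedFiber.edge N ω k φ))) ∧
    TwistedFiber.edge N ω k (Real.pi / N) = ω - 2 * k * Real.cos (Real.pi / N) ∧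
    (∀ φ : ℝ, TwistedFiber.edge N ω k φ ≤ TwistedFiber.edge N ω k (Real.pi / N)) :=
  ⟨fun _ P hpos => ⟨TwistedFiber.essentialSpectrum_linearization hk P,
    TwistedFiber.mem_lowerBand_iff_neg_mem_upperBand _, TwistedFiber.disjoint_bands hpos⟩,
    TwistedFiber.edge_pi_div N ω k, TwistedFiber.edge_le_edge_pi_div N hk⟩
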